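/- For a real matrix $A=(A_{ij})\in\mathbb{R}^{a\times b}$ write $\|A\|_{\ell^\infty\to\ell^\infty}:=\sup_{|x|_\infty\le 1}|Ax|_\infty=\max_{i}\sum_{j}|A_{ij}|$, and let $\mathbf 1_{a,b}$ be the $a\times b$ matrix with all entries equal to $1$. Let $p\ge 1$ be an integer and let $\mu_1,\dots,\mu_p$ be fixed probability laws on $\mathbb{R}$ that are centered, have unit variance and have a finite fourth moment. For all integers $n_0,\dots,n_p\ge 1$, let $A^{(q)}=(A^{(q)}_{ij})_{1\le i\le n_{q-1},\,1\le j\le n_q}$, $q=1,\dots,p$, be independent random matrices, the entries of $A^{(q)}$ being i.i.d. with law $\mu_q$, and let $$P:=A^{(1)}\cdots A^{(p)}\in\mathbb{R}^{n_0\times n_p}.$$ Then, for any integers $m=m(n_0,\dots,n_p)\ge 1$, $$m^{-1}\,(2\,n_1\cdots n_p\,\log n_0)^{-\frac12}\,\|P\,\mathbf 1_{n_p,m}\|_{\ell^\infty\to\ell^\infty}\longrightarrow 1\quad\text{in probability as } n_0\asymp\cdots\asymp n_p\to\infty .$$ The latter means that, for every $C<\infty$ and all $\varepsilon,\delta>0$,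 there exists $N\in\mathbb{N}$ such that, whenever $N\le n_q\le C\,n_{q'}$ for all $q,q'\in\{0,\dots,p\}$, the left-hand side differs from $1$ by at least $\varepsilon$ with probability at most $\delta$. -/

import Mathlib

open MeasureTheory ProbabilityTheory

/-- The product `A 0 * A 1 * ⋯ * A (p - 1)`, of size `n 0 × n p`, of `p` matrices of compatible
sizes, where `A q` has `n q` rows and `n (q + 1)` columns. The empty product is the identity. -/
noncomputable def matProd : (p : ℕ) → (n : Fin (p + 1) → ℕ) →
    ((q : Fin p) → Matrix (Fin (n q.castSucc)) (Fin (n q.succ)) ℝ) →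
    Matrix (Fin (n 0)) (Fin (n (Fin.last p))) ℝ
  | 0, n, _ => (1 : Matrix (Fin (n 0)) (Fin (n 0)) ℝ)
  | p + 1, n, A => A 0 * matProd p (fun k => n k.succ) (fun q => A q.succ)

/-- The `ℓ^∞ → ℓ^∞` operator norm of a real matrix. The spaces `Fin b → ℝ` and `Fin a → ℝ` carry
the supremum norm, so this is the supremum of `|A x|_∞` over the `x` with `|x|_∞ ≤ 1`. -/
noncomputable def linftyNorm {a b : ℕ} (A : Matrix (Fin a) (Fin b) ℝ) : ℝ :=
  ‖LinearMap.toContinuousLinearMap (Matrix.toLin' A)‖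

/-- The `a × b` matrix with all entries equal to `1`. -/
def onesMatrix (a b : ℕ) : Matrix (Fin a) (Fin b) ℝ :=
  Matrix.of fun _ _ => 1

/-- Convergence in probability of `U (n₀, …, n_p)` to the constant `c` as
`n₀ ≍ ⋯ ≍ n_p → ∞`. For each size vector `n`, the variable `U n` may live on its own
probability space `(Ω n, Pr n)`. -/
def TendstoInProbComparable {p : ℕ} {Ω : (Fin (p + 1) → ℕ) → Type*}
    [∀ n, MeasurableSpace (Ω n)] (Pr : ∀ n, Measure (Ω n)) (U : ∀ n, Ω n → ℝ) (c : ℝ) : Prop :=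
  ∀ C ε δ : ℝ, 0 < ε → 0 < δ → ∃ N : ℕ, ∀ n : Fin (p + 1) → ℕ,
    (∀ q q' : Fin (p + 1), N ≤ n q ∧ (n q : ℝ) ≤ C * (n q' : ℝ)) →
    (Pr n).real {ω | ε ≤ |U n ω - c|} ≤ δ

/-! Multiplying by a matrix of ones leaves a rank-one map, so its norm is `m` times the sup norm of
the product applied to the vector of ones (`linftyNorm_mul_onesMatrix`). That vector is `B V`, where
`B` is the first matrix and `V`, the product of the other matrices applied to ones, is independent
of `B`. Given `V`, the coordinates of `B V` are i.i.d. with variance `|V|₂²`. If `V` is delocalized,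
they have Gaussian tails up to the scale that matters for a maximum of `n 0` variables, and the
maximum is close to `|V|₂ √(2 log (n 0))`.

Two facts about `V` are needed: `|V|₂²` is close to its mean `N`, the product of all sizes except `n
0`, and `∑ V_j⁴` is `O(N² / n 0)`. Conditioning on one matrix at a time, `prodVec_moments` gives the
exact mean of `|V|₂²`, a second moment at most `N² ∏ (1 + K / n_q)`, and a matching bound on `∑
V_j⁴`. Chebyshev and Markov then suffice.

For a fixed unit vector `w` (`eventually_norm_rowMul_concentrates`), a fourth moment gives no
exponential moments, so the summands `x_j w_j` are truncated at a small multiple of `√(log a)`,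
where `a` is the number of rows. By Markov with fourth powers, the truncation changes nothing with
probability `1 - O((log a)⁻²)`. The truncated sum has moment generating function within a factor 2
of the Gaussian one at arguments of order `√(log a)`. The upper bound on the maximum is Chernoff
plus a union bound. The lower bound comes from a tilting estimate (`le_measure_ge_of_mgf_bounds`)
and independence of the rows. -/

/-! ### Second and fourth moments of linear forms and of `B c` -/

/-- The fourth moment of a sum of two independent centered variables. -/
theorem IndepFun.fourth_moment_add {Ω : Type*} [MeasurableSpace Ω] {P : Measure Ω}
    [IsProbabilityMeasure P] {X Y : Ω → ℝ} (h : IndepFun X Y P) (hX : MemLp X 4 P)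
    (hY : MemLp Y 4 P) (hX0 : ∫ ω, X ω ∂P = 0) (hY0 : ∫ ω, Y ω ∂P = 0) :
    (∫ ω, (X ω + Y ω) ^ 2 ∂P = ∫ ω, X ω ^ 2 ∂P + ∫ ω, Y ω ^ 2 ∂P) ∧
    (∫ ω, (X ω + Y ω) ^ 4 ∂P = ∫ ω, X ω ^ 4 ∂P +
      6 * ((∫ ω, X ω ^ 2 ∂P) * ∫ ω, Y ω ^ 2 ∂P) + ∫ ω, Y ω ^ 4 ∂P) := by
  have hpow : ∀ {Z : Ω → ℝ}, MemLp Z 4 P → ∀ k : ℕ, k ≤ 4 → Integrable (fun ω => Z ω ^ k) P := by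
    intro Z hZ k hk
    have hk' : MemLp Z (k : ENNReal) P := hZ.mono_exponent (by exact_mod_cast hk)
    have := hk'.integrable_norm_pow'
    refine this.mono (hZ.1.pow k) ?_
    filter_upwards with ω
    simp
  have hind : ∀ k l : ℕ, IndepFun (fun ω => X ω ^ k) (fun ω => Y ω ^ l) P := fun k l =>
    h.comp (φ := fun x : ℝ => x ^ k) (ψ := fun x : ℝ => x ^ l) (by fun_prop) (by fun_prop)
  have hint : ∀ k l : ℕ, k ≤ 4 → l ≤ 4 → Integrable (fun ω => X ω ^ k * Y ω ^ l) P :=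
    fun k l hk hl => (hind k l).integrable_mul (hpow hX k hk) (hpow hY l hl)
  have hmul : ∀ k l : ℕ, ∫ ω, X ω ^ k * Y ω ^ l ∂P = (∫ ω, X ω ^ k ∂P) * ∫ ω, Y ω ^ l ∂P :=
    fun k l => (hind k l).integral_fun_mul_eq_mul_integral
      (hX.1.pow k) (hY.1.pow l)
  have hX1 : ∫ ω, X ω ^ 1 ∂P = 0 := by simpa using hX0
  have hY1 : ∫ ω, Y ω ^ 1 ∂P = 0 := by simpa using hY0
  have hX2 := hpow hX 2 (by norm_num)
  have hX4 := hpow hX 4 (by norm_num)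
  have hY2 := hpow hY 2 (by norm_num)
  have hY4 := hpow hY 4 (by norm_num)
  constructor
  · have e : ∀ ω, (X ω + Y ω) ^ 2 = X ω ^ 2 + 2 * (X ω ^ 1 * Y ω ^ 1) + Y ω ^ 2 := by
      intro ω; ring
    have h11 := (hint 1 1 (by norm_num) (by norm_num)).const_mul 2
    simp_rw [e]
    rw [integral_add (by exact hX2.add h11) hY2, integral_add hX2 h11, integral_const_mul, hmul, hX1]
    ring
  · have e : ∀ ω, (X ω + Y ω) ^ 4 = X ω ^ 4 + 4 * (X ω ^ 3 * Y ω ^ 1) + 6 * (X ω ^ 2 * Y ω ^ 2)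
        + 4 * (X ω ^ 1 * Y ω ^ 3) + Y ω ^ 4 := by
      intro ω; ring
    have h31 := (hint 3 1 (by norm_num) (by norm_num)).const_mul 4
    have h22 := (hint 2 2 (by norm_num) (by norm_num)).const_mul 6
    have h13 := (hint 1 3 (by norm_num) (by norm_num)).const_mul 4
    simp_rw [e]
    rw [integral_add (by exact ((hX4.add h31).add h22).add h13) hY4,
      integral_add (by exact (hX4.add h31).add h22) h13,
      integral_add (by exact hX4.add h31) h22, integral_add hX4 h31]
    simp only [integral_const_mul, hmul, hX1, hY1]
    ring

/-- Second and fourth moments of a linear combination of i.i.d. variables with mean zero,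
unit variance and finite fourth moment. -/
theorem linear_form_moments (ν : Measure ℝ) [IsProbabilityMeasure ν] (h4 : MemLp (id : ℝ → ℝ) 4 ν)
    (h1 : ∫ x, x ∂ν = 0) (h2 : ∫ x, x ^ 2 ∂ν = 1) {ι : Type*} [Fintype ι] (c : ι → ℝ)
    (s : Finset ι) :
    MemLp (fun x : ι → ℝ => ∑ j ∈ s, x j * c j) 4 (Measure.pi fun _ => ν) ∧
    ∫ x, ∑ j ∈ s, x j * c j ∂(Measure.pi fun _ : ι => ν) = 0 ∧
    ∫ x, (∑ j ∈ s, x j * c j) ^ 2 ∂(Measure.pi fun _ : ι => ν) = ∑ j ∈ s, c j ^ 2 ∧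
    ∫ x, (∑ j ∈ s, x j * c j) ^ 4 ∂(Measure.pi fun _ : ι => ν) ≤
      (3 + ∫ x, x ^ 4 ∂ν) * (∑ j ∈ s, c j ^ 2) ^ 2 := by
  classical
  have hev : ∀ (j : ι) (f : ℝ → ℝ) (_ : AEStronglyMeasurable f ν),
      ∫ x, f (x j) ∂(Measure.pi fun _ : ι => ν) = ∫ x, f x ∂ν := by
    intro j f hf
    have := (measurePreserving_eval (fun _ : ι => ν) j).map_eq
    conv_rhs => rw [← this]
    rw [integral_map (measurable_pi_apply j).aemeasurable (by rw [this]; exact hf)]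
  have hκ : 0 ≤ ∫ x, x ^ 4 ∂ν := integral_nonneg fun x => by positivity
  induction s using Finset.induction_on with
  | empty => simp
  | insert j s hj ih =>
    obtain ⟨ihL, ih1, ih2, ih4⟩ := ih
    have hXL : MemLp (fun x : ι → ℝ => x j * c j) 4 (Measure.pi fun _ => ν) :=
      (h4.comp_measurePreserving (measurePreserving_eval (fun _ : ι => ν) j)).mul_const _
    have hX1 : ∫ x, x j * c j ∂(Measure.pi fun _ : ι => ν) = 0 := by
      rw [integral_mul_const, hev j (fun x => x) (by fun_prop), h1, zero_mul]
    have hX2 : ∫ x, (x j * c j) ^ 2 ∂(Measure.pi fun _ : ι => ν) = c j ^ 2 := by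
      simp_rw [mul_pow]
      rw [integral_mul_const, hev j (fun x => x ^ 2) (by fun_prop), h2, one_mul]
    have hX4 : ∫ x, (x j * c j) ^ 4 ∂(Measure.pi fun _ : ι => ν) = (∫ x, x ^ 4 ∂ν) * c j ^ 4 := by
      simp_rw [mul_pow]
      rw [integral_mul_const, hev j (fun x => x ^ 4) (by fun_prop)]
    have hind : IndepFun (fun x : ι → ℝ => x j * c j) (fun x : ι → ℝ => ∑ j ∈ s, x j * c j)
        (Measure.pi fun _ : ι => ν) := by
      have h := iIndepFun_pi (μ := fun _ : ι => ν) (X := fun j x => x * c j)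
        (fun j => by fun_prop)
      have h' := h.indepFun_finsetSum_of_notMem (fun j => by fun_prop) hj
      have e : (∑ j ∈ s, fun x : ι → ℝ => x j * c j) = fun x : ι → ℝ => ∑ j ∈ s, x j * c j := by
        ext x; simp
      rw [e] at h'
      exact h'.symm
    obtain ⟨e2, e4⟩ := IndepFun.fourth_moment_add hind hXL ihL hX1 ih1
    simp only [Finset.sum_insert hj]
    refine ⟨hXL.add ihL, ?_, ?_, ?_⟩
    · rw [integral_add (hXL.integrable (by norm_num)) (ihL.integrable (by norm_num)), hX1, ih1,
        add_zero]
    · rw [e2, hX2, ih2]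
    · rw [e4, hX2, ih2, hX4]
      have hs : 0 ≤ ∑ j ∈ s, c j ^ 2 := Finset.sum_nonneg fun _ _ => sq_nonneg _
      -- With `κ` the fourth moment and `s` the partial sum of squares, the slack is `3 c_j⁴ + 2 κ
      -- c_j² s`.
      nlinarith [mul_nonneg hκ (mul_nonneg (sq_nonneg (c j)) hs), sq_nonneg (c j ^ 2)]

/-- The law of an `a × b` matrix with i.i.d. entries of law `ν`. -/
noncomputable def iidMatrixLaw (ν : Measure ℝ) (a b : ℕ) : Measure (Fin a → Fin b → ℝ) :=
  Measure.pi fun _ => Measure.pi fun _ => ν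

instance (ν : Measure ℝ) [IsProbabilityMeasure ν] (a b : ℕ) :
    IsProbabilityMeasure (iidMatrixLaw ν a b) := by
  unfold iidMatrixLaw; infer_instance

/-- The matrix-vector product, for a matrix given by its rows. -/
def rowMul {a b : ℕ} (x : Fin a → Fin b → ℝ) (c : Fin b → ℝ) (i : Fin a) : ℝ :=
  ∑ j, x i j * c j

theorem measurable_rowMul {a b : ℕ} :
    Measurable fun z : (Fin a → Fin b → ℝ) × (Fin b → ℝ) => rowMul z.1 z.2 := by
  unfold rowMul; fun_prop

/-- Moments of `B c` for a matrix `B` with i.i.d. entries and a fixed vector `c`. -/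
theorem iidMatrix_moments (ν : Measure ℝ) [IsProbabilityMeasure ν] (h4 : MemLp (id : ℝ → ℝ) 4 ν)
    (h1 : ∫ x, x ∂ν = 0) (h2 : ∫ x, x ^ 2 ∂ν = 1) (a b : ℕ) (c : Fin b → ℝ) :
    (∀ i, MemLp (fun x => rowMul x c i) 4 (iidMatrixLaw ν a b)) ∧
    ∫ x, ∑ i, rowMul x c i ^ 2 ∂(iidMatrixLaw ν a b) = a * ∑ j, c j ^ 2 ∧
    ∫ x, ∑ i, rowMul x c i ^ 4 ∂(iidMatrixLaw ν a b) ≤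
      a * (3 + ∫ x, x ^ 4 ∂ν) * (∑ j, c j ^ 2) ^ 2 ∧
    ∫ x, (∑ i, rowMul x c i ^ 2) ^ 2 ∂(iidMatrixLaw ν a b) ≤
      (a ^ 2 + a * (3 + ∫ x, x ^ 4 ∂ν)) * (∑ j, c j ^ 2) ^ 2 := by
  obtain ⟨hL, -, e2, e4⟩ := linear_form_moments ν h4 h1 h2 c Finset.univ
  set ρ : Measure (Fin b → ℝ) := Measure.pi fun _ => ν with hρ
  have hmeas : ∀ k : ℕ, Measurable fun y : Fin b → ℝ => (∑ j, y j * c j) ^ k := fun k => by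
    fun_prop
  have hmp : ∀ i, MeasurePreserving (fun x : Fin a → Fin b → ℝ => x i) (iidMatrixLaw ν a b) ρ :=
    fun i => measurePreserving_eval (fun _ : Fin a => ρ) i
  have hev : ∀ (i : Fin a) (k : ℕ), ∫ x, rowMul x c i ^ k ∂(iidMatrixLaw ν a b) =
      ∫ y, (∑ j, y j * c j) ^ k ∂ρ := by
    intro i k
    rw [← (hmp i).map_eq, integral_map (hmp i).measurable.aemeasurable
      (hmeas k).aestronglyMeasurable]
    rfl
  have hiL : ∀ i, MemLp (fun x => rowMul x c i) 4 (iidMatrixLaw ν a b) := fun i =>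
    hL.comp_measurePreserving (hmp i)
  have hsqL : MemLp (fun y : Fin b → ℝ => (∑ j, y j * c j) ^ 2) 2 ρ := by
    have := hL.norm_rpow_div 2
    have e : (4 : ENNReal) / 2 = 2 := by
      refine ((ENNReal.eq_div_iff (by norm_num) (by norm_num)).2 ?_).symm
      norm_num
    rw [e] at this
    refine this.congr_norm (hmeas 2).aestronglyMeasurable ?_
    filter_upwards with y
    simp
  have hisq : ∀ i, MemLp (fun x => rowMul x c i ^ 2) 2 (iidMatrixLaw ν a b) := fun i =>
    hsqL.comp_measurePreserving (hmp i)
  have hi2 : ∀ i, Integrable (fun x => rowMul x c i ^ 2) (iidMatrixLaw ν a b) := fun i =>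
    (hisq i).integrable (by norm_num)
  have hi4 : ∀ i, Integrable (fun x => rowMul x c i ^ 4) (iidMatrixLaw ν a b) := fun i => by
    have := (hisq i).integrable_sq
    simpa only [← pow_mul] using this
  have m2 : ∫ x, ∑ i, rowMul x c i ^ 2 ∂(iidMatrixLaw ν a b) = a * ∑ j, c j ^ 2 := by
    rw [integral_finsetSum _ fun i _ => hi2 i]
    simp only [hev, e2, Finset.sum_const, Finset.card_univ, Fintype.card_fin, nsmul_eq_mul]
  refine ⟨hiL, m2, ?_, ?_⟩
  · rw [integral_finsetSum _ fun i _ => hi4 i]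
    simp only [hev, Finset.sum_const, Finset.card_univ, Fintype.card_fin, nsmul_eq_mul]
    rw [mul_assoc]
    gcongr
  -- Second moment as squared mean plus variance. The rows are independent, so the variance is only
  -- linear in `a`, each row contributing at most its fourth moment.
  · have hsumL : MemLp (fun x => ∑ i, rowMul x c i ^ 2) 2 (iidMatrixLaw ν a b) :=
      memLp_finsetSum _ fun i _ => hisq i
    have hv := variance_eq_sub hsumL
    have hv2 : Var[fun x => ∑ i, rowMul x c i ^ 2; iidMatrixLaw ν a b] =
        ∑ i : Fin a, Var[fun y : Fin b → ℝ => (∑ j, y j * c j) ^ 2; ρ] := by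
      rw [← variance_sum_pi (μ := fun _ : Fin a => ρ)
        (X := fun _ y => (∑ j, y j * c j) ^ 2) fun _ => hsqL]
      congr 1
      ext x; simp [rowMul]
    have hv3 : Var[fun y : Fin b → ℝ => (∑ j, y j * c j) ^ 2; ρ] ≤
        (3 + ∫ x, x ^ 4 ∂ν) * (∑ j, c j ^ 2) ^ 2 := by
      refine (variance_le_expectation_sq (hmeas 2).aestronglyMeasurable).trans ?_
      refine le_trans (le_of_eq ?_) e4
      congr 1
      ext y; simp [← pow_mul]
    rw [m2, hv2] at hv
    simp only [Finset.sum_const, Finset.card_univ, Fintype.card_fin, nsmul_eq_mul, Pi.pow_apply]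
      at hv
    have : (a : ℝ) * Var[fun y : Fin b → ℝ => (∑ j, y j * c j) ^ 2; ρ] ≤
        a * ((3 + ∫ x, x ^ 4 ∂ν) * (∑ j, c j ^ 2) ^ 2) := by gcongr
    nlinarith

/-! ### Truncated linear forms and their moment generating functions -/

/-- Truncation at level `T`. -/
noncomputable def trunc (T x : ℝ) : ℝ := if |x| ≤ T then x else 0

theorem measurable_trunc (T : ℝ) : Measurable (trunc T) := by
  unfold trunc
  exact Measurable.ite (measurableSet_le (by fun_prop) (by fun_prop)) measurable_id
    measurable_const

theorem abs_trunc_le {T : ℝ} (hT : 0 ≤ T) (x : ℝ) : |trunc T x| ≤ T := by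
  unfold trunc
  split_ifs with h
  · exact h
  · simpa using hT

/-- The Taylor polynomial is taken at `x`, not at its truncation, so that it integrates exactly for
a centered law and no recentering is needed. Below the level this is the cubic Taylor remainder.
Above it, `1 ≤ |l| * T` forces `|l * x| ≥ 1`, and the cubic term dominates the linear and quadratic
ones. -/
theorem abs_exp_trunc_sub_le {l T : ℝ} (hlT : 1 ≤ |l| * T) (x : ℝ) :
    |Real.exp (l * trunc T x) - 1 - l * x - l ^ 2 * x ^ 2 / 2| ≤
      2 * |l| ^ 3 * |x| ^ 3 * Real.exp (|l| * T) := by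
  have hl : 0 < |l| := by
    by_contra h
    have : |l| = 0 := le_antisymm (not_lt.1 h) (abs_nonneg _)
    rw [this] at hlT; norm_num at hlT
  unfold trunc
  split_ifs with h
  · have h1 := Complex.norm_exp_sub_sum_le_norm_mul_exp ((l * x : ℝ) : ℂ) 3
    have e : Complex.exp ((l * x : ℝ) : ℂ) -
        ∑ m ∈ Finset.range 3, ((l * x : ℝ) : ℂ) ^ m / (m.factorial : ℂ) =
        ((Real.exp (l * x) - 1 - l * x - l ^ 2 * x ^ 2 / 2 : ℝ) : ℂ) := by
      simp [Finset.sum_range_succ]; ring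
    rw [e, Complex.norm_real, Complex.norm_real, Real.norm_eq_abs, Real.norm_eq_abs, abs_mul] at h1
    refine h1.trans ?_
    have h2 : Real.exp (|l| * |x|) ≤ Real.exp (|l| * T) := by gcongr
    calc (|l| * |x|) ^ 3 * Real.exp (|l| * |x|)
        ≤ (|l| * |x|) ^ 3 * Real.exp (|l| * T) := by gcongr
      _ ≤ 2 * ((|l| * |x|) ^ 3 * Real.exp (|l| * T)) := by
          have : 0 ≤ (|l| * |x|) ^ 3 * Real.exp (|l| * T) := by positivity
          linarith
      _ = _ := by ring
  · have hx : 1 ≤ |l * x| := by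
      rw [abs_mul]
      exact hlT.trans (by gcongr; exact (not_le.1 h).le)
    have he : 1 ≤ Real.exp (|l| * T) := Real.one_le_exp (by linarith)
    have : |Real.exp (l * 0) - 1 - l * x - l ^ 2 * x ^ 2 / 2| ≤ |l * x| + |l * x| ^ 2 / 2 := by
      rw [mul_zero, Real.exp_zero, sq_abs, ← mul_pow]
      have : (1 - 1 - l * x - (l * x) ^ 2 / 2) = -(l * x + (l * x) ^ 2 / 2) := by ring
      rw [this, abs_neg]
      refine (abs_add_le _ _).trans ?_
      gcongr
      rw [abs_of_nonneg (by positivity)]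
    refine this.trans ?_
    have h3 : |l * x| + |l * x| ^ 2 / 2 ≤ 2 * |l * x| ^ 3 := by
      nlinarith [mul_nonneg (sub_nonneg.2 hx) (abs_nonneg (l * x)),
        mul_nonneg (mul_nonneg (sub_nonneg.2 hx) (abs_nonneg (l * x))) (abs_nonneg (l * x))]
    refine h3.trans ?_
    rw [abs_mul]
    calc 2 * (|l| * |x|) ^ 3 ≤ 2 * (|l| * |x|) ^ 3 * Real.exp (|l| * T) :=
          le_mul_of_one_le_right (by positivity) he
      _ = _ := by ring

/-- One factor of the moment generating function of a truncated linear form. -/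
theorem abs_integral_exp_trunc_sub_le (ν : Measure ℝ) [IsProbabilityMeasure ν]
    (h4 : MemLp (id : ℝ → ℝ) 4 ν) (h1 : ∫ x, x ∂ν = 0) (h2 : ∫ x, x ^ 2 ∂ν = 1)
    {l T : ℝ} (hT : 0 ≤ T) (hlT : 1 ≤ |l| * T) (w : ℝ) :
    |∫ x, Real.exp (l * trunc T (x * w)) ∂ν - (1 + l ^ 2 * w ^ 2 / 2)| ≤
      2 * |l| ^ 3 * |w| ^ 3 * (∫ x, |x| ^ 3 ∂ν) * Real.exp (|l| * T) := by
  have hi1 : Integrable (fun x : ℝ => x) ν := h4.integrable (by norm_num)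
  have hi2 : Integrable (fun x : ℝ => x ^ 2) ν :=
    MemLp.integrable_sq (h4.mono_exponent (by norm_num))
  have hi3 : Integrable (fun x : ℝ => |x| ^ 3) ν := by
    have hk' : MemLp (id : ℝ → ℝ) ((3 : ℕ) : ENNReal) ν := h4.mono_exponent (by norm_num)
    simpa using hk'.integrable_norm_pow'
  have hie : Integrable (fun x : ℝ => Real.exp (l * trunc T (x * w))) ν := by
    refine Integrable.of_bound (C := Real.exp (|l| * T)) ?_ ?_
    · exact (Real.measurable_exp.comp (((measurable_trunc T).comp
        (measurable_id.mul_const w)).const_mul l)).aestronglyMeasurable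
    · filter_upwards with x
      rw [Real.norm_eq_abs, Real.abs_exp]
      refine Real.exp_le_exp.2 ((le_abs_self _).trans ?_)
      rw [abs_mul]
      exact mul_le_mul_of_nonneg_left (abs_trunc_le hT _) (abs_nonneg _)
  have e : ∫ x, Real.exp (l * trunc T (x * w)) ∂ν - (1 + l ^ 2 * w ^ 2 / 2) =
      ∫ x, (Real.exp (l * trunc T (x * w)) - 1 - l * (x * w) - l ^ 2 * (x * w) ^ 2 / 2) ∂ν := by
    have h5 : ∀ x : ℝ, Real.exp (l * trunc T (x * w)) - 1 - l * (x * w) - l ^ 2 * (x * w) ^ 2 / 2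
      = Real.exp (l * trunc T (x * w)) - (1 + (l * w) * x + (l ^ 2 * w ^ 2 / 2) * x ^ 2) := by
      intro x; ring
    simp_rw [h5]
    have hc : Integrable (fun _ : ℝ => (1 : ℝ)) ν := integrable_const 1
    rw [integral_sub hie (by exact (hc.add (hi1.const_mul _)).add (hi2.const_mul _)),
      integral_add (by exact hc.add (hi1.const_mul _)) (hi2.const_mul _),
      integral_add hc (hi1.const_mul _)]
    rw [integral_const_mul, integral_const_mul, h1, h2]
    simp
  rw [e]
  have hb : ∫ x, 2 * |l| ^ 3 * |x * w| ^ 3 * Real.exp (|l| * T) ∂ν =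
      2 * |l| ^ 3 * |w| ^ 3 * (∫ x, |x| ^ 3 ∂ν) * Real.exp (|l| * T) := by
    simp_rw [abs_mul, mul_pow]
    rw [integral_mul_const, integral_const_mul, integral_mul_const]
    ring
  rw [← hb, ← Real.norm_eq_abs]
  refine norm_integral_le_of_norm_le ?_ ?_
  · simp_rw [abs_mul, mul_pow]
    exact ((hi3.mul_const _).const_mul _).mul_const _
  · filter_upwards with x
    exact abs_exp_trunc_sub_le hlT _

theorem one_sub_sum_le_prod_one_sub {ι : Type*} (s : Finset ι) (d : ι → ℝ)
    (hd0 : ∀ j ∈ s, 0 ≤ d j) (hd1 : ∀ j ∈ s, d j ≤ 1) :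
    1 - ∑ j ∈ s, d j ≤ ∏ j ∈ s, (1 - d j) := by
  classical
  induction s using Finset.induction_on with
  | empty => simp
  | insert j s hj ih =>
    rw [Finset.sum_insert hj, Finset.prod_insert hj]
    have h1 := ih (fun i hi => hd0 i (Finset.mem_insert_of_mem hi))
      (fun i hi => hd1 i (Finset.mem_insert_of_mem hi))
    have h2 : 0 ≤ ∑ i ∈ s, d i :=
      Finset.sum_nonneg fun i hi => hd0 i (Finset.mem_insert_of_mem hi)
    nlinarith [hd0 j (Finset.mem_insert_self j s), hd1 j (Finset.mem_insert_self j s)]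

/-- A product of factors close to exponentials is close to the exponential of the sum. -/
theorem prod_bounds_of_abs_sub_exp_le {ι : Type*} (s : Finset ι) (x y d : ι → ℝ)
    (hy : ∀ j ∈ s, 0 ≤ y j) (hd : ∀ j ∈ s, |x j - Real.exp (y j)| ≤ d j)
    (hD : ∑ j ∈ s, d j ≤ 1 / 2) :
    Real.exp (∑ j ∈ s, y j) / 2 ≤ ∏ j ∈ s, x j ∧
      ∏ j ∈ s, x j ≤ 2 * Real.exp (∑ j ∈ s, y j) := by
  have hd0 : ∀ j ∈ s, 0 ≤ d j := fun j hj => (abs_nonneg _).trans (hd j hj)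
  have hd1 : ∀ j ∈ s, d j ≤ 1 := fun j hj =>
    (Finset.single_le_sum hd0 hj).trans (hD.trans (by norm_num))
  -- Since `y j ≥ 0`, each exponential is at least 1, so the additive error `d j` is also a relative
  -- error.
  have he : ∀ j ∈ s, 1 ≤ Real.exp (y j) := fun j hj => Real.one_le_exp (hy j hj)
  have hlo : ∀ j ∈ s, Real.exp (y j) * (1 - d j) ≤ x j := fun j hj => by
    have := (abs_le.1 (hd j hj)).1
    nlinarith [he j hj, hd0 j hj]
  have hhi : ∀ j ∈ s, x j ≤ Real.exp (y j) * Real.exp (d j) := fun j hj => by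
    have h1 := (abs_le.1 (hd j hj)).2
    have h2 := Real.add_one_le_exp (d j)
    nlinarith [he j hj, hd0 j hj]
  rw [Real.exp_sum]
  constructor
  · have h1 : 1 - ∑ j ∈ s, d j ≤ ∏ j ∈ s, (1 - d j) :=
      one_sub_sum_le_prod_one_sub s d hd0 hd1
    calc (∏ j ∈ s, Real.exp (y j)) / 2 = (∏ j ∈ s, Real.exp (y j)) * (1 / 2) := by ring
      _ ≤ (∏ j ∈ s, Real.exp (y j)) * ∏ j ∈ s, (1 - d j) := by
          refine mul_le_mul_of_nonneg_left (by linarith) ?_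
          exact Finset.prod_nonneg fun _ _ => (Real.exp_pos _).le
      _ = ∏ j ∈ s, Real.exp (y j) * (1 - d j) := (Finset.prod_mul_distrib).symm
      _ ≤ _ := Finset.prod_le_prod (fun j hj => mul_nonneg (Real.exp_pos _).le
          (sub_nonneg.2 (hd1 j hj))) hlo
  · calc ∏ j ∈ s, x j ≤ ∏ j ∈ s, (Real.exp (y j) * Real.exp (d j)) :=
          Finset.prod_le_prod (fun j hj => (mul_nonneg (Real.exp_pos _).le
          (sub_nonneg.2 (hd1 j hj))).trans (hlo j hj)) hhi
      _ = Real.exp (∑ j ∈ s, d j) * ∏ j ∈ s, Real.exp (y j) := by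
          rw [Finset.prod_mul_distrib, Real.exp_sum, mul_comm]
      _ ≤ 2 * ∏ j ∈ s, Real.exp (y j) := by
          refine mul_le_mul_of_nonneg_right ?_
            (Finset.prod_nonneg fun _ _ => (Real.exp_pos _).le)
          · have h1 : Real.exp (∑ j ∈ s, d j) ≤ Real.exp (1 / 2) := by gcongr
            have h2 : Real.exp (1 / 2) ^ 2 = Real.exp 1 := by
              rw [← Real.exp_nat_mul]; norm_num
            have h3 := Real.exp_one_lt_d9
            nlinarith [Real.exp_pos (1 / 2 : ℝ)]

/-- Sum of truncated independent contributions. -/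
noncomputable def truncForm {b : ℕ} (T : ℝ) (w : Fin b → ℝ) (y : Fin b → ℝ) : ℝ :=
  ∑ j, trunc T (y j * w j)

theorem measurable_truncForm {b : ℕ} (T : ℝ) (w : Fin b → ℝ) : Measurable (truncForm T w) := by
  unfold truncForm
  exact Finset.measurable_sum _ fun j _ => (measurable_trunc T).comp (by fun_prop)

theorem abs_truncForm_le {b : ℕ} {T : ℝ} (hT : 0 ≤ T) (w y : Fin b → ℝ) :
    |truncForm T w y| ≤ b * T := by
  unfold truncForm
  refine (Finset.abs_sum_le_sum_abs _ _).trans ?_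
  refine (Finset.sum_le_sum fun j _ => abs_trunc_le hT _).trans ?_
  simp

theorem integrable_exp_truncForm {b : ℕ} {T : ℝ} (hT : 0 ≤ T) (w : Fin b → ℝ) (l : ℝ)
    (P : Measure (Fin b → ℝ)) [IsFiniteMeasure P] :
    Integrable (fun y => Real.exp (l * truncForm T w y)) P := by
  refine Integrable.of_bound (C := Real.exp (|l| * (b * T))) ?_ ?_
  · exact (Real.measurable_exp.comp ((measurable_truncForm T w).const_mul l)).aestronglyMeasurable
  · filter_upwards with x
    rw [Real.norm_eq_abs, Real.abs_exp]
    refine Real.exp_le_exp.2 ((le_abs_self _).trans ?_)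
    rw [abs_mul]
    exact mul_le_mul_of_nonneg_left (abs_truncForm_le hT _ _) (abs_nonneg _)

/-- Two-sided Gaussian bounds for the moment generating function of a truncated linear form. -/
theorem mgf_truncForm_bounds (ν : Measure ℝ) [IsProbabilityMeasure ν]
    (h4 : MemLp (id : ℝ → ℝ) 4 ν) (h1 : ∫ x, x ∂ν = 0) (h2 : ∫ x, x ^ 2 ∂ν = 1)
    {l T k : ℝ} (hT : 0 ≤ T) (hlT : 1 ≤ |l| * T) {b : ℕ} (w : Fin b → ℝ)
    (hw2 : ∑ j, w j ^ 2 = 1) (hw4 : ∑ j, w j ^ 4 ≤ k)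
    (hD : 2 * |l| ^ 3 * √k * (∫ x, |x| ^ 3 ∂ν) * Real.exp (|l| * T) + l ^ 4 * k / 4 ≤ 1 / 2) :
    Real.exp (l ^ 2 / 2) / 2 ≤ mgf (truncForm T w) (Measure.pi fun _ => ν) l ∧
      mgf (truncForm T w) (Measure.pi fun _ => ν) l ≤ 2 * Real.exp (l ^ 2 / 2) := by
  have hρ : 0 ≤ ∫ x, |x| ^ 3 ∂ν := integral_nonneg fun x => by positivity
  have hmgf : mgf (truncForm T w) (Measure.pi fun _ => ν) l =
      ∏ j, ∫ x, Real.exp (l * trunc T (x * w j)) ∂ν := by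
    rw [← integral_fintype_prod_eq_prod]
    simp only [mgf, truncForm, Finset.mul_sum, Real.exp_sum]
  -- Cauchy–Schwarz applied to `|w j| * w j ^ 2`, with `w` of unit length.
  have hw3 : ∑ j, |w j| ^ 3 ≤ √k := by
    apply Real.le_sqrt_of_sq_le
    have := Finset.sum_mul_sq_le_sq_mul_sq Finset.univ (fun j => |w j|) (fun j => w j ^ 2)
    simp only [sq_abs, hw2, one_mul, ← pow_mul] at this
    refine le_trans (le_of_eq ?_) (this.trans hw4)
    congr 1
    refine Finset.sum_congr rfl fun j _ => ?_
    rw [← sq_abs (w j)]; ring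
  have hk : 0 ≤ k := le_trans (Finset.sum_nonneg fun j _ => by positivity) hw4
  have hbig : 0 ≤ 2 * |l| ^ 3 * √k * (∫ x, |x| ^ 3 ∂ν) * Real.exp (|l| * T) := by positivity
  have hsmall : ∀ j, |l ^ 2 * w j ^ 2 / 2| ≤ 1 := by
    intro j
    have h5 : w j ^ 4 ≤ k := le_trans
      (Finset.single_le_sum (f := fun j => w j ^ 4) (fun j _ => by positivity) (Finset.mem_univ j))
      hw4
    have h6 : l ^ 4 * w j ^ 4 ≤ l ^ 4 * k := by gcongr
    rw [← sq_le_one_iff_abs_le_one]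
    nlinarith
  -- Each factor has two errors: the truncated Taylor error, and the replacement of `1 + y` by `exp
  -- y`, which costs `y ^ 2` because `|y| ≤ 1`.
  have key := prod_bounds_of_abs_sub_exp_le Finset.univ
    (fun j => ∫ x, Real.exp (l * trunc T (x * w j)) ∂ν) (fun j => l ^ 2 * w j ^ 2 / 2)
    (fun j => 2 * |l| ^ 3 * |w j| ^ 3 * (∫ x, |x| ^ 3 ∂ν) * Real.exp (|l| * T) +
      (l ^ 2 * w j ^ 2 / 2) ^ 2) (fun j _ => by positivity) (fun j _ => ?_) ?_
  · rw [hmgf]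
    have e : ∑ j, l ^ 2 * w j ^ 2 / 2 = l ^ 2 / 2 := by
      rw [← Finset.sum_div, ← Finset.mul_sum, hw2, mul_one]
    rwa [e] at key
  · have h5 := abs_integral_exp_trunc_sub_le ν h4 h1 h2 hT hlT (w j)
    have h6 := Real.abs_exp_sub_one_sub_id_le (hsmall j)
    rw [abs_le] at *
    constructor <;> linarith [h5.1, h5.2, h6.1, h6.2]
  · rw [Finset.sum_add_distrib, ← Finset.sum_mul, ← Finset.sum_mul, ← Finset.mul_sum]
    refine le_trans ?_ hD
    have e : ∑ j, (l ^ 2 * w j ^ 2 / 2) ^ 2 = l ^ 4 / 4 * ∑ j, w j ^ 4 := by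
      rw [Finset.mul_sum]
      exact Finset.sum_congr rfl fun j _ => by ring
    rw [e]
    have : l ^ 4 * k / 4 = l ^ 4 / 4 * k := by ring
    rw [this]
    gcongr

/-- Asymptotic form of `mgf_truncForm_bounds`. -/
theorem eventually_mgf_truncForm_bounds (ν : Measure ℝ) [IsProbabilityMeasure ν]
    (h4 : MemLp (id : ℝ → ℝ) 4 ν) (h1 : ∫ x, x ∂ν = 0) (h2 : ∫ x, x ^ 2 ∂ν = 1)
    (K : ℝ) {c η : ℝ} (hc : c ≠ 0) (hη : 0 < η) (hcη : |c| * η ≤ 1 / 4) :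
    ∀ᶠ a : ℕ in Filter.atTop, ∀ (b : ℕ) (w : Fin b → ℝ), ∑ j, w j ^ 2 = 1 →
      ∑ j, w j ^ 4 ≤ K / a →
      Real.exp ((c * √(Real.log a)) ^ 2 / 2) / 2 ≤
        mgf (truncForm (η * √(Real.log a)) w) (Measure.pi fun _ => ν) (c * √(Real.log a)) ∧
      mgf (truncForm (η * √(Real.log a)) w) (Measure.pi fun _ => ν) (c * √(Real.log a)) ≤
        2 * Real.exp ((c * √(Real.log a)) ^ 2 / 2) := by
  set ρ := ∫ x, |x| ^ 3 ∂ν with hρ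
  have hρ0 : 0 ≤ ρ := integral_nonneg fun x => by positivity
  have hlog : Filter.Tendsto (fun a : ℕ => Real.log a) Filter.atTop Filter.atTop :=
    Real.tendsto_log_atTop.comp tendsto_natCast_atTop_atTop
  -- The error terms in the variable `L = log a`. The factor `exp (|l| * T)` is at most `exp (L /
  -- 4)` and `√(K / a)` is `√K * exp (-L / 2)`, so the product still decays exponentially in `L`.
  have hlim : Filter.Tendsto (fun L : ℝ => 2 * |c| ^ 3 * √K * ρ * (L ^ 2 * Real.exp (-(1/4) * L)) +
      c ^ 4 * K / 4 * (L ^ 2 * Real.exp (-1 * L))) Filter.atTop (nhds 0) := by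
    have hh : ∀ β : ℝ, 0 < β → Filter.Tendsto (fun L : ℝ => L ^ 2 * Real.exp (-β * L))
        Filter.atTop (nhds 0) := fun β hβ => by
      have := tendsto_rpow_mul_exp_neg_mul_atTop_nhds_zero 2 β hβ
      simpa using this
    have := ((hh (1/4) (by norm_num)).const_mul (2 * |c| ^ 3 * √K * ρ)).add
      ((hh 1 one_pos).const_mul (c ^ 4 * K / 4))
    simpa using this
  have hc0 : 0 < |c| := abs_pos.2 hc
  filter_upwards [hlog.eventually (hlim.eventually (gt_mem_nhds (show (0:ℝ) < 1 / 2 by norm_num))),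
    hlog.eventually_ge_atTop 1, hlog.eventually_ge_atTop (1 / (|c| * η)),
    Filter.eventually_gt_atTop 0] with a ha1 ha2 ha3 ha4 b w hw2 hw4
  have ha : (0 : ℝ) < a := by exact_mod_cast ha4
  set L := Real.log a with hL
  have hL0 : 0 ≤ L := by linarith
  have hsq : √L * √L = L := Real.mul_self_sqrt hL0
  have haL : (a : ℝ) = Real.exp L := (Real.exp_log ha).symm
  have e1 : |c * √L| * (η * √L) = |c| * η * L := by
    rw [abs_mul, abs_of_nonneg (Real.sqrt_nonneg L)]
    linear_combination (|c| * η) * hsq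
  refine mgf_truncForm_bounds ν h4 h1 h2 (by positivity) ?_ w hw2 hw4 ?_
  · rw [e1]
    rw [div_le_iff₀ (by positivity)] at ha3
    linarith
  · refine le_trans ?_ ha1.le
    rw [e1, ← hρ]
    have hK : 0 ≤ K := by
      have : 0 ≤ K / a := le_trans (Finset.sum_nonneg fun j _ => by positivity) hw4
      by_contra h
      have := div_neg_of_neg_of_pos (not_le.1 h) ha
      linarith
    have e2 : √(K / a) = √K * Real.exp (-(1/2) * L) := by
      have e : Real.exp (-L) = Real.exp (-(1/2) * L) ^ 2 := by
        rw [← Real.exp_nat_mul]; congr 1; push_cast; ring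
      rw [div_eq_mul_inv, Real.sqrt_mul hK, haL, ← Real.exp_neg, e,
        Real.sqrt_sq (Real.exp_pos _).le]
    have e3 : √L ^ 3 ≤ L ^ 2 := by
      have h5 : 1 ≤ √L := by rwa [Real.one_le_sqrt]
      calc √L ^ 3 ≤ √L ^ 4 := pow_le_pow_right₀ h5 (by norm_num)
        _ = (√L * √L) ^ 2 := by ring
        _ = L ^ 2 := by rw [hsq]
    have e4 : (c * √L) ^ 4 * (K / a) / 4 = c ^ 4 * K / 4 * (L ^ 2 * Real.exp (-1 * L)) := by
      have : √L ^ 4 = L ^ 2 := by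
        calc √L ^ 4 = (√L * √L) ^ 2 := by ring
          _ = L ^ 2 := by rw [hsq]
      rw [mul_pow, this, haL, div_eq_mul_inv K, ← Real.exp_neg]
      ring_nf
    rw [e4, e2]
    refine add_le_add_left ?_ _
    have e5 : Real.exp (|c| * η * L) ≤ Real.exp (1 / 4 * L) := by gcongr
    calc 2 * |c * √L| ^ 3 * (√K * Real.exp (-(1/2) * L)) * ρ * Real.exp (|c| * η * L)
        = 2 * |c| ^ 3 * √K * ρ * (√L ^ 3 * (Real.exp (-(1/2) * L) * Real.exp (|c| * η * L))) := by
          rw [abs_mul, abs_of_nonneg (Real.sqrt_nonneg L)]; ring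
      _ ≤ 2 * |c| ^ 3 * √K * ρ * (L ^ 2 * (Real.exp (-(1/2) * L) * Real.exp (1 / 4 * L))) := by
          gcongr
      _ = 2 * |c| ^ 3 * √K * ρ * (L ^ 2 * Real.exp (-(1/4) * L)) := by
          rw [← Real.exp_add]
          ring_nf

/-! ### Tail bounds from the moment generating function -/

/-- Two-sided Chernoff bound at level `t`. -/
theorem measure_abs_ge_le_of_mgf_le {Ω : Type*} [MeasurableSpace Ω] {P : Measure Ω}
    [IsProbabilityMeasure P] {S : Ω → ℝ} {t : ℝ} (ht : 0 ≤ t)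
    (hint : ∀ l, Integrable (fun ω => Real.exp (l * S ω)) P)
    (hp : mgf S P t ≤ 2 * Real.exp (t ^ 2 / 2)) (hn : mgf S P (-t) ≤ 2 * Real.exp ((-t) ^ 2 / 2)) :
    P.real {ω | t ≤ |S ω|} ≤ 4 * Real.exp (-(t ^ 2 / 2)) := by
  have h1 := measure_ge_le_exp_mul_mgf (μ := P) (X := S) (t := t) t ht (hint t)
  have h2 := measure_le_le_exp_mul_mgf (μ := P) (X := S) (t := -t) (-t) (by linarith) (hint (-t))
  have hsub : {ω | t ≤ |S ω|} ⊆ {ω | t ≤ S ω} ∪ {ω | S ω ≤ -t} := by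
    intro ω hω
    rcases le_abs.1 (show t ≤ |S ω| from hω) with h | h
    · exact Or.inl h
    · exact Or.inr (by simp only [Set.mem_ofPred_eq]; linarith)
  have h3 := (measureReal_mono hsub (μ := P)).trans (measureReal_union_le _ _)
  have e : Real.exp (-t * t) * (2 * Real.exp (t ^ 2 / 2)) = 2 * Real.exp (-(t ^ 2 / 2)) := by
    rw [mul_left_comm, ← Real.exp_add]; ring_nf
  have e1 : Real.exp (-t * t) * mgf S P t ≤ 2 * Real.exp (-(t ^ 2 / 2)) := by
    rw [← e]; gcongr
  have e2 : Real.exp (- -t * -t) * mgf S P (-t) ≤ 2 * Real.exp (-(t ^ 2 / 2)) := by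
    rw [← e, show - -t * -t = -t * t by ring]
    rw [neg_sq] at hn
    gcongr
  linarith

/-- A lower bound on the tail from two-sided bounds on the moment generating function. -/
theorem le_measure_ge_of_mgf_bounds {Ω : Type*} [MeasurableSpace Ω] {P : Measure Ω}
    [IsProbabilityMeasure P] {S : Ω → ℝ} (hS : Measurable S) {x β : ℝ} (hx : 0 ≤ x) (hβ : 0 ≤ β)
    (hint : ∀ l, Integrable (fun ω => Real.exp (l * S ω)) P)
    (h0 : Real.exp (x ^ 2 / 2) / 2 ≤ mgf S P x)
    (hp : mgf S P ((1 + β) * x) ≤ 2 * Real.exp (((1 + β) * x) ^ 2 / 2))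
    (hn : mgf S P ((1 - β) * x) ≤ 2 * Real.exp (((1 - β) * x) ^ 2 / 2))
    (hlarge : 4 * Real.exp (-(β ^ 2 * x ^ 2 / 2)) ≤ 1 / 4) :
    Real.exp (-((1 / 2 + β) * x ^ 2)) / 4 ≤ P.real {ω | (1 - β) * x ≤ S ω} := by
  set E : Set Ω := {ω | (1 - β) * x ≤ S ω} with hE
  have hEm : MeasurableSet E := measurableSet_le measurable_const hS
  -- The mass of `exp (x * S)` should sit near `S = x`. Beyond `(1 + β) * x` it is dominated by a
  -- larger tilt, below `(1 - β) * x` by a smaller one, and in between by a constant on `E`.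
  have hpt : ∀ ω, Real.exp (x * S ω) ≤ E.indicator (fun _ => Real.exp ((1 + β) * x ^ 2)) ω +
      Real.exp (-(β * x * ((1 + β) * x))) * Real.exp ((1 + β) * x * S ω) +
      Real.exp (β * x * ((1 - β) * x)) * Real.exp ((1 - β) * x * S ω) := by
    intro ω
    have hβx : 0 ≤ β * x := mul_nonneg hβ hx
    rw [← Real.exp_add, ← Real.exp_add]
    have p1 := Real.exp_pos (-(β * x * ((1 + β) * x)) + (1 + β) * x * S ω)
    have p2 := Real.exp_pos (β * x * ((1 - β) * x) + (1 - β) * x * S ω)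
    have p3 : 0 ≤ E.indicator (fun _ => Real.exp ((1 + β) * x ^ 2)) ω :=
      Set.indicator_nonneg (fun _ _ => (Real.exp_pos _).le) _
    by_cases h1 : ω ∈ E
    · by_cases h2 : S ω ≤ (1 + β) * x
      · have : Real.exp (x * S ω) ≤ E.indicator (fun _ => Real.exp ((1 + β) * x ^ 2)) ω := by
          rw [Set.indicator_of_mem h1]
          apply Real.exp_le_exp.2
          nlinarith
        linarith
      · have : Real.exp (x * S ω) ≤
            Real.exp (-(β * x * ((1 + β) * x)) + (1 + β) * x * S ω) := by
          apply Real.exp_le_exp.2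
          nlinarith [mul_nonneg hβx (sub_nonneg.2 (not_le.1 h2).le)]
        linarith
    · have h2 : S ω ≤ (1 - β) * x := (not_le.1 h1).le
      have : Real.exp (x * S ω) ≤ Real.exp (β * x * ((1 - β) * x) + (1 - β) * x * S ω) := by
        apply Real.exp_le_exp.2
        nlinarith [mul_nonneg hβx (sub_nonneg.2 h2)]
      linarith
  have hi1 : Integrable (E.indicator (fun _ => Real.exp ((1 + β) * x ^ 2))) P :=
    (integrable_const _).indicator hEm
  have hi2 := (hint ((1 + β) * x)).const_mul (Real.exp (-(β * x * ((1 + β) * x))))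
  have hi3 := (hint ((1 - β) * x)).const_mul (Real.exp (β * x * ((1 - β) * x)))
  have hmain : mgf S P x ≤ P.real E * Real.exp ((1 + β) * x ^ 2) +
      Real.exp (-(β * x * ((1 + β) * x))) * mgf S P ((1 + β) * x) +
      Real.exp (β * x * ((1 - β) * x)) * mgf S P ((1 - β) * x) := by
    have := integral_mono (hint x) ((hi1.add hi2).add hi3) hpt
    refine this.trans (le_of_eq ?_)
    simp only [Pi.add_apply]
    rw [integral_add (by exact hi1.add hi2) hi3, integral_add hi1 hi2, integral_const_mul,
      integral_const_mul, integral_indicator_const _ hEm]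
    rfl
  -- Completing the square: both changes of tilt gain the same factor `exp (-(β * x) ^ 2 / 2)` over
  -- `exp (x ^ 2 / 2)`.
  have t1 : Real.exp (-(β * x * ((1 + β) * x))) * mgf S P ((1 + β) * x) ≤
      2 * Real.exp (-(β ^ 2 * x ^ 2 / 2)) * Real.exp (x ^ 2 / 2) := by
    calc _ ≤ Real.exp (-(β * x * ((1 + β) * x))) * (2 * Real.exp (((1 + β) * x) ^ 2 / 2)) := by
          gcongr
      _ = _ := by
          rw [mul_left_comm, ← Real.exp_add, mul_assoc 2, ← Real.exp_add]; ring_nf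
  have t2 : Real.exp (β * x * ((1 - β) * x)) * mgf S P ((1 - β) * x) ≤
      2 * Real.exp (-(β ^ 2 * x ^ 2 / 2)) * Real.exp (x ^ 2 / 2) := by
    calc _ ≤ Real.exp (β * x * ((1 - β) * x)) * (2 * Real.exp (((1 - β) * x) ^ 2 / 2)) := by
          gcongr
      _ = _ := by
          rw [mul_left_comm, ← Real.exp_add, mul_assoc 2, ← Real.exp_add]; ring_nf
  have hq := Real.exp_pos (x ^ 2 / 2)
  -- Of the total weight `1 / 2`, the two outer parts take at most `1 / 4` by `hlarge`.
  have t3 : Real.exp (x ^ 2 / 2) / 4 ≤ P.real E * Real.exp ((1 + β) * x ^ 2) := by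
    nlinarith
  have e : Real.exp (-((1 / 2 + β) * x ^ 2)) =
      Real.exp (x ^ 2 / 2) / Real.exp ((1 + β) * x ^ 2) := by
    rw [← Real.exp_sub]; ring_nf
  rw [e, div_right_comm, div_le_iff₀ (Real.exp_pos _)]
  exact t3

/-! ### Sup norm of `B w` for a fixed delocalized unit vector -/

theorem iidMatrixLaw_measurePreserving_row (ν : Measure ℝ) [IsProbabilityMeasure ν] {a b : ℕ}
    (i : Fin a) : MeasurePreserving (fun x : Fin a → Fin b → ℝ => x i) (iidMatrixLaw ν a b)
      (Measure.pi fun _ => ν) :=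
  measurePreserving_eval (fun _ : Fin a => (Measure.pi fun _ : Fin b => ν)) i

/-- With high probability no entry `x i j * w j` is large. -/
theorem iidMatrixLaw_exists_large_le (ν : Measure ℝ) [IsProbabilityMeasure ν]
    (h4 : MemLp (id : ℝ → ℝ) 4 ν) {a b : ℕ} (w : Fin b → ℝ) {T : ℝ} (hT : 0 < T) :
    (iidMatrixLaw ν a b).real {x | ∃ i j, T ≤ |x i j * w j|} ≤
      a * ((∫ x, x ^ 4 ∂ν) * ∑ j, w j ^ 4) / T ^ 4 := by
  have hi4 : Integrable (fun x : ℝ => x ^ 4) ν := by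
    have hk' : MemLp (id : ℝ → ℝ) ((4 : ℕ) : ENNReal) ν := by exact_mod_cast h4
    have := hk'.integrable_norm_pow'
    simpa [Even.pow_abs (show Even 4 by decide)] using this
  have hone : ∀ (i : Fin a) (j : Fin b), (iidMatrixLaw ν a b).real {x | T ≤ |x i j * w j|} ≤
      (∫ x, x ^ 4 ∂ν) * w j ^ 4 / T ^ 4 := by
    intro i j
    have hmp := (measurePreserving_eval (fun _ : Fin b => ν) j).comp
      (iidMatrixLaw_measurePreserving_row ν (b := b) i)
    have hset : MeasurableSet {y : ℝ | T ≤ |y * w j|} :=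
      measurableSet_le measurable_const (by fun_prop)
    have e : (iidMatrixLaw ν a b).real {x | T ≤ |x i j * w j|} = ν.real {y | T ≤ |y * w j|} :=
      hmp.measureReal_preimage hset.nullMeasurableSet
    have hsub : {y : ℝ | T ≤ |y * w j|} ⊆ {y | T ^ 4 ≤ y ^ 4 * w j ^ 4} := by
      intro y hy
      simp only [Set.mem_ofPred_eq] at hy ⊢
      rw [← mul_pow, ← Even.pow_abs (show Even 4 by decide) (y * w j)]
      gcongr
    have := mul_meas_ge_le_integral_of_nonneg (μ := ν) (f := fun y => y ^ 4 * w j ^ 4)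
      (Filter.Eventually.of_forall fun y => by positivity) (hi4.mul_const _) (T ^ 4)
    rw [integral_mul_const] at this
    rw [e, le_div_iff₀ (by positivity), mul_comm]
    exact (mul_le_mul_of_nonneg_left (measureReal_mono hsub) (by positivity)).trans this
  have hset : {x : Fin a → Fin b → ℝ | ∃ i j, T ≤ |x i j * w j|} =
      ⋃ i, ⋃ j, {x | T ≤ |x i j * w j|} := by
    ext x; simp
  rw [hset]
  calc _ ≤ ∑ i : Fin a, ∑ j : Fin b, (iidMatrixLaw ν a b).real {x | T ≤ |x i j * w j|} :=
        (measureReal_iUnion_fintype_le _).trans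
          (Finset.sum_le_sum fun i _ => measureReal_iUnion_fintype_le _)
    _ ≤ ∑ i : Fin a, ∑ j : Fin b, (∫ x, x ^ 4 ∂ν) * w j ^ 4 / T ^ 4 :=
        Finset.sum_le_sum fun i _ => Finset.sum_le_sum fun j _ => hone i j
    _ = _ := by
        rw [Finset.sum_const, Finset.card_univ, Fintype.card_fin, nsmul_eq_mul, ← Finset.sum_div,
          ← Finset.mul_sum]
        ring

/-- The sup norm of `B w`, for `B` with `a` i.i.d. rows and a delocalized unit vector `w`,
concentrates around `√(2 log a)`. -/
theorem eventually_norm_rowMul_concentrates (ν : Measure ℝ) [IsProbabilityMeasure ν]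
    (h4 : MemLp (id : ℝ → ℝ) 4 ν) (h1 : ∫ x, x ∂ν = 0) (h2 : ∫ x, x ^ 2 ∂ν = 1)
    (K : ℝ) {ε δ : ℝ} (hε : 0 < ε) (hε1 : ε ≤ 1) (hδ : 0 < δ) :
    ∀ᶠ a : ℕ in Filter.atTop, ∀ (b : ℕ) (w : Fin b → ℝ), ∑ j, w j ^ 2 = 1 →
      ∑ j, w j ^ 4 ≤ K / a →
      (iidMatrixLaw ν a b).real {x | ε * √(2 * Real.log a) ≤
        |‖rowMul x w‖ - √(2 * Real.log a)|} ≤ δ := by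
  set κ := ∫ x, x ^ 4 ∂ν with hκ
  have hκ0 : 0 ≤ κ := integral_nonneg fun x => by positivity
  -- Two factors `1 - β` are lost, one in the tilt and one in the tail threshold, and `(1 - β) ^ 2 ≥
  -- 1 - ε`.
  set β := ε / 2 with hβ
  have hβ0 : 0 < β := by positivity
  have hβ1 : β ≤ 1 / 2 := by rw [hβ]; linarith
  -- The expected number of rows above the lower level is at least `a ^ γ / 4`.
  set γ := 1 - (1 - β) ^ 2 * (1 + 2 * β) with hγ
  have hγ0 : 0 < γ := by
    have : γ = β ^ 2 * (3 - 2 * β) := by rw [hγ]; ring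
    rw [this]
    have : 0 < 3 - 2 * β := by linarith
    positivity
  have hlog : Filter.Tendsto (fun a : ℕ => Real.log a) Filter.atTop Filter.atTop :=
    Real.tendsto_log_atTop.comp tendsto_natCast_atTop_atTop
  have hexp : ∀ {g : ℝ}, 0 < g → Filter.Tendsto (fun L : ℝ => Real.exp (-(g * L))) Filter.atTop
      (nhds 0) := fun hg => Real.tendsto_exp_neg_atTop_nhds_zero.comp
        (Filter.tendsto_id.const_mul_atTop hg)
  have hlim : Filter.Tendsto (fun L : ℝ => κ * K * 16 ^ 4 * (L ^ 2)⁻¹ +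
      4 * Real.exp (-(2 * ε * L)) + Real.exp (-(1 / 4 * Real.exp (γ * L)))) Filter.atTop
      (nhds 0) := by
    have l1 : Filter.Tendsto (fun L : ℝ => (L ^ 2)⁻¹) Filter.atTop (nhds 0) :=
      tendsto_inv_atTop_zero.comp (Filter.tendsto_pow_atTop two_ne_zero)
    have l3 : Filter.Tendsto (fun L : ℝ => Real.exp (-(1 / 4 * Real.exp (γ * L)))) Filter.atTop
        (nhds 0) := (hexp (by norm_num : (0:ℝ) < 1 / 4)).comp
          (Real.tendsto_exp_atTop.comp (Filter.tendsto_id.const_mul_atTop hγ0))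
    have := ((l1.const_mul (κ * K * 16 ^ 4)).add
      ((hexp (by positivity : 0 < 2 * ε)).const_mul 4)).add l3
    simpa using this
  have hlim2 : Filter.Tendsto (fun L : ℝ => 4 * Real.exp (-(β ^ 2 * (1 - β) ^ 2 * L)))
      Filter.atTop (nhds 0) := by
    have hb : 0 < 1 - β := by linarith
    simpa using (hexp (by positivity : 0 < β ^ 2 * (1 - β) ^ 2)).const_mul 4
  have hs2 : 0 < √(2 : ℝ) := by positivity
  have hs2' : √(2 : ℝ) ≤ 2 := by
    rw [Real.sqrt_le_left (by norm_num)]; norm_num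
  -- The value `1 / 16` meets the requirement `|c * √2| * η ≤ 1 / 4`, since `|c| ≤ 2` and `√2 ≤ 2`.
  have hmgf : ∀ c : ℝ, 0 < |c| → |c| ≤ 2 → _ := fun c hc0 hc =>
    eventually_mgf_truncForm_bounds ν h4 h1 h2 K (c := c * √2) (η := 1 / 16)
      (mul_ne_zero (abs_pos.1 hc0) hs2.ne') (by norm_num) (by
        rw [abs_mul, abs_of_pos hs2]; nlinarith)
  have habs : ∀ c : ℝ, 0 < c → 0 < |c| := fun c hc => abs_pos.2 hc.ne'
  have pB : 0 < 1 - β := by linarith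
  -- The arguments `±(1 + ε)` serve the Chernoff bound. The other three are the base tilt `1 - β`
  -- and its two perturbations in the lower tail bound.
  filter_upwards [hmgf (1 + ε) (habs _ (by linarith)) (by rw [abs_of_pos] <;> linarith),
    hmgf (-(1 + ε)) (by rw [abs_neg]; exact habs _ (by linarith))
      (by rw [abs_neg, abs_of_pos] <;> linarith),
    hmgf (1 - β) (habs _ pB) (by rw [abs_of_pos] <;> linarith),
    hmgf ((1 + β) * (1 - β)) (habs _ (by positivity)) (by rw [abs_of_pos (by positivity)]; nlinarith),
    hmgf ((1 - β) * (1 - β)) (habs _ (by positivity)) (by rw [abs_of_pos (by positivity)]; nlinarith),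
    hlog.eventually (hlim.eventually (gt_mem_nhds hδ)),
    hlog.eventually (hlim2.eventually (gt_mem_nhds (show (0:ℝ) < 1 / 4 by norm_num))),
    hlog.eventually_ge_atTop 1, Filter.eventually_gt_atTop 0]
    with a m1 m2 m3 m4 m5 hδL hβL hL1 ha0 b w hw2 hw4
  obtain ⟨-, m1⟩ := m1 b w hw2 hw4
  obtain ⟨-, m2⟩ := m2 b w hw2 hw4
  obtain ⟨m3, -⟩ := m3 b w hw2 hw4
  obtain ⟨-, m4⟩ := m4 b w hw2 hw4
  obtain ⟨-, m5⟩ := m5 b w hw2 hw4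
  have ha : (0 : ℝ) < a := by exact_mod_cast ha0
  set L := Real.log a with hL
  have haL : (a : ℝ) = Real.exp L := (Real.exp_log ha).symm
  have hL0 : 0 < L := by linarith
  set T := 1 / 16 * √L with hT
  have hT0 : 0 < T := by positivity
  have hT4 : T ^ 4 = L ^ 2 / 16 ^ 4 := by
    have : √L ^ 4 = (√L ^ 2) ^ 2 := by ring
    rw [hT, mul_pow, this, Real.sq_sqrt hL0.le]; ring
  have hR : √(2 * L) = √2 * √L := Real.sqrt_mul (by norm_num) L
  set R := √(2 * L) with hRdef
  have hR2 : R ^ 2 = 2 * L := Real.sq_sqrt (by positivity)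
  have hR0 : 0 < R := by positivity
  simp only [mul_assoc, ← hR] at m1 m2 m3 m4 m5
  set ρ : Measure (Fin b → ℝ) := Measure.pi fun _ => ν with hρ
  have hint : ∀ l, Integrable (fun y => Real.exp (l * truncForm T w y)) ρ := fun l =>
    integrable_exp_truncForm hT0.le w l ρ
  have hSm := measurable_truncForm T w
  -- Delocalization cancels the number of rows, leaving `T ^ 4`, of order `L ^ 2`, in the
  -- denominator.
  have hTr : (iidMatrixLaw ν a b).real {x | ∃ i j, T ≤ |x i j * w j|} ≤
      κ * K * 16 ^ 4 * (L ^ 2)⁻¹ := by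
    refine (iidMatrixLaw_exists_large_le ν h4 w hT0).trans ?_
    rw [hT4]
    calc a * (κ * ∑ j, w j ^ 4) / (L ^ 2 / 16 ^ 4) ≤ a * (κ * (K / a)) / (L ^ 2 / 16 ^ 4) := by
          gcongr
      _ = _ := by field_simp
  have hUp : (iidMatrixLaw ν a b).real {x | ∃ i, (1 + ε) * R ≤ |truncForm T w (x i)|} ≤
      4 * Real.exp (-(2 * ε * L)) := by
    have hset : {x : Fin a → Fin b → ℝ | ∃ i, (1 + ε) * R ≤ |truncForm T w (x i)|} =
      ⋃ i, {x | (1 + ε) * R ≤ |truncForm T w (x i)|} := by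
      ext x; simp
    have hone : ∀ i : Fin a, (iidMatrixLaw ν a b).real
        {x | (1 + ε) * R ≤ |truncForm T w (x i)|} ≤ 4 * Real.exp (-(((1 + ε) * R) ^ 2 / 2)) := by
      intro i
      have hset : MeasurableSet {y : Fin b → ℝ | (1 + ε) * R ≤ |truncForm T w y|} :=
        measurableSet_le measurable_const hSm.abs
      have e := (iidMatrixLaw_measurePreserving_row ν (b := b) i).measureReal_preimage
        hset.nullMeasurableSet
      refine e.trans_le ?_
      refine measure_abs_ge_le_of_mgf_le (by positivity) hint m1 ?_
      rw [← neg_mul]; exact m2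
    rw [hset]
    refine (measureReal_iUnion_fintype_le _).trans ((Finset.sum_le_sum fun i _ => hone i).trans ?_)
    rw [Finset.sum_const, Finset.card_univ, Fintype.card_fin, nsmul_eq_mul, haL, mul_left_comm,
      ← Real.exp_add, mul_pow, hR2]
    gcongr
    nlinarith [mul_nonneg (sq_nonneg ε) hL0.le]
  -- Independent rows turn this probability into an `a`-th power, and `(1 - q) ^ a ≤ exp (-(a * q))`
  -- with `a * q = exp (γ * L) / 4`.
  have hLo : (iidMatrixLaw ν a b).real {x | ∀ i, truncForm T w (x i) < (1 - β) * ((1 - β) * R)} ≤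
      Real.exp (-(1 / 4 * Real.exp (γ * L))) := by
    have hset : {x : Fin a → Fin b → ℝ | ∀ i, truncForm T w (x i) < (1 - β) * ((1 - β) * R)} =
        Set.univ.pi fun _ => {y | truncForm T w y < (1 - β) * ((1 - β) * R)} := by
      ext x; simp
    have htail := le_measure_ge_of_mgf_bounds (P := ρ) hSm (x := (1 - β) * R) (β := β)
      (by positivity) hβ0.le hint m3 m4 m5 (by
        rw [mul_pow, hR2]
        refine le_trans (le_of_eq ?_) hβL.le
        ring_nf)
    have hcompl : ρ.real {y | truncForm T w y < (1 - β) * ((1 - β) * R)} =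
        1 - ρ.real {y | (1 - β) * ((1 - β) * R) ≤ truncForm T w y} := by
      rw [← probReal_compl_eq_one_sub (measurableSet_le measurable_const hSm)]
      congr 1
      ext y; simp
    have e1 : (iidMatrixLaw ν a b).real (Set.univ.pi fun _ =>
        {y | truncForm T w y < (1 - β) * ((1 - β) * R)}) =
        ρ.real {y | truncForm T w y < (1 - β) * ((1 - β) * R)} ^ a := by
      rw [Measure.real, iidMatrixLaw, Measure.pi_pi]
      simp [Measure.real, hρ]
    rw [hset, e1, hcompl]
    set q := Real.exp (-((1 / 2 + β) * ((1 - β) * R) ^ 2)) / 4 with hq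
    calc _ ≤ (Real.exp (-q)) ^ a := by
          refine pow_le_pow_left₀ (sub_nonneg.2 measureReal_le_one) ?_ a
          have := Real.one_sub_le_exp_neg q
          linarith
      _ = _ := by
          rw [← Real.exp_nat_mul, haL, hq, mul_pow, hR2, hγ]
          congr 1
          rw [mul_neg, ← mul_div_assoc, ← Real.exp_add]
          rw [div_eq_inv_mul]
          norm_num
          ring
  -- Off the first event the truncation is inactive. A sup norm that is too small forces every
  -- coordinate to be small, so a one-sided lower bound suffices.
  have hsub : {x : Fin a → Fin b → ℝ | ε * R ≤ |‖rowMul x w‖ - R|} ⊆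
      {x | ∃ i j, T ≤ |x i j * w j|} ∪ {x | ∃ i, (1 + ε) * R ≤ |truncForm T w (x i)|} ∪
      {x | ∀ i, truncForm T w (x i) < (1 - β) * ((1 - β) * R)} := by
    intro x hx
    simp only [Set.mem_ofPred_eq] at hx
    by_cases hx1 : x ∈ {x : Fin a → Fin b → ℝ | ∃ i j, T ≤ |x i j * w j|}
    · exact Or.inl (Or.inl hx1)
    have hx2 : ∀ i j, |x i j * w j| < T := by
      simpa using hx1
    have hx3 : ∀ i, truncForm T w (x i) = rowMul x w i := fun i =>
      Finset.sum_congr rfl fun j _ => if_pos (hx2 i j).le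
    rcases le_abs.1 hx with h | h
    · refine Or.inl (Or.inr ?_)
      simp only [Set.mem_ofPred_eq, hx3]
      by_contra! hcon
      have := (pi_norm_lt_iff (x := rowMul x w) (r := (1 + ε) * R) (by positivity)).2
        fun i => hcon i
      linarith
    · refine Or.inr ?_
      simp only [Set.mem_ofPred_eq, hx3]
      intro i
      have h5 := (le_abs_self _).trans (norm_le_pi_norm (rowMul x w) i)
      have h6 : (1 - β) * ((1 - β) * R) = (1 - ε) * R + β ^ 2 * R := by rw [hβ]; ring
      have h7 : 0 < β ^ 2 * R := by positivity
      linarith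
  have h8 := (measureReal_mono hsub (μ := iidMatrixLaw ν a b)).trans
    ((measureReal_union_le _ _).trans (add_le_add_left (measureReal_union_le _ _) _))
  linarith

/-! ### Reduction to a vector, and independence of the factors -/

/-- The product sends `x` to `(∑ x_k)` times a fixed vector, and on the unit ball `|∑ x_k|` is
largest, equal to `m`, at the constant vector 1. -/
theorem linftyNorm_mul_onesMatrix {a b : ℕ} (M : Matrix (Fin a) (Fin b) ℝ) {m : ℕ} (hm : 1 ≤ m) :
    linftyNorm (M * onesMatrix b m) = m * ‖M.mulVec fun _ => 1‖ := by
  have happ : ∀ x : Fin m → ℝ, (M * onesMatrix b m).mulVec x =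
      (∑ k, x k) • M.mulVec fun _ => 1 := by
    intro x
    rw [← Matrix.mulVec_mulVec, ← Matrix.mulVec_smul]
    congr 1
    ext j
    simp [onesMatrix, Matrix.mulVec, dotProduct]
  unfold linftyNorm
  refine le_antisymm (ContinuousLinearMap.opNorm_le_bound _ (by positivity) fun x => ?_) ?_
  · rw [LinearMap.coe_toContinuousLinearMap', Matrix.toLin'_apply, happ, norm_smul]
    have : ‖∑ k, x k‖ ≤ m * ‖x‖ := by
      refine (norm_sum_le _ _).trans ((Finset.sum_le_sum fun k _ => norm_le_pi_norm x k).trans ?_)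
      simp
    calc _ ≤ m * ‖x‖ * ‖M.mulVec fun _ => 1‖ := by gcongr
      _ = _ := by ring
  · have := (LinearMap.toContinuousLinearMap (Matrix.toLin' (M * onesMatrix b m))).le_opNorm
      (fun _ => 1)
    rw [LinearMap.coe_toContinuousLinearMap', Matrix.toLin'_apply, happ, norm_smul] at this
    have : Nonempty (Fin m) := ⟨⟨0, hm⟩⟩
    have h1 : ‖(fun _ => 1 : Fin m → ℝ)‖ = 1 := by rw [pi_norm_const]; simp
    simp_all

/-- The product of the matrices `A q`, applied to the vector of ones. -/
noncomputable def prodVec (p : ℕ) (n : Fin (p + 1) → ℕ)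
    (A : (q : Fin p) → Matrix (Fin (n q.castSucc)) (Fin (n q.succ)) ℝ) : Fin (n 0) → ℝ :=
  (matProd p n A).mulVec fun _ => 1

theorem prodVec_zero (n : Fin 1 → ℕ)
    (A : (q : Fin 0) → Matrix (Fin (n q.castSucc)) (Fin (n q.succ)) ℝ) :
    prodVec 0 n A = fun _ => 1 := by
  unfold prodVec matProd
  exact Matrix.one_mulVec _

theorem prodVec_succ (p : ℕ) (n : Fin (p + 2) → ℕ)
    (A : (q : Fin (p + 1)) → Matrix (Fin (n q.castSucc)) (Fin (n q.succ)) ℝ) :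
    prodVec (p + 1) n A = rowMul (A 0) (prodVec p (fun k => n k.succ) fun q => A q.succ) := by
  unfold prodVec
  rw [matProd]
  exact (Matrix.mulVec_mulVec _ _ _).symm

theorem measurable_prodVec {α : Type*} [MeasurableSpace α] (p : ℕ) (n : Fin (p + 1) → ℕ)
    (F : α → (q : Fin p) → Matrix (Fin (n q.castSucc)) (Fin (n q.succ)) ℝ)
    (hF : ∀ q i j, Measurable fun x => F x q i j) :
    Measurable fun x => prodVec p n (F x) := by
  induction p with
  | zero => simp only [prodVec_zero]; exact measurable_const
  | succ p ih =>
    simp only [prodVec_succ]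
    have h1 : Measurable fun x => (fun i j => F x 0 i j) :=
      measurable_pi_lambda _ fun i => measurable_pi_lambda _ fun j => hF 0 i j
    exact measurable_rowMul.comp (h1.prodMk
      (ih (fun k => n k.succ) (fun x q => F x q.succ) fun q i j => hF q.succ i j))

/-- Independence gives a product law indexed by pairs, while `iidMatrixLaw` is an iterated product;
currying identifies the two. -/
theorem hasLaw_iidMatrixLaw {Ω : Type*} [MeasurableSpace Ω] {P : Measure Ω}
    [IsProbabilityMeasure P] {ν : Measure ℝ} [IsProbabilityMeasure ν] {a b : ℕ}
    {X : Fin a → Fin b → Ω → ℝ} (hlaw : ∀ i j, HasLaw (X i j) ν P)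
    (hindep : iIndepFun (fun e : Fin a × Fin b => X e.1 e.2) P) :
    HasLaw (fun ω i j => X i j ω) (iidMatrixLaw ν a b) P := by
  have haem : AEMeasurable (fun ω (e : Fin a × Fin b) => X e.1 e.2 ω) P :=
    aemeasurable_pi_lambda _ fun e => (hlaw e.1 e.2).aemeasurable
  have h1 := (iIndepFun_iff_map_fun_eq_pi_map (f := fun e : Fin a × Fin b => X e.1 e.2)
    fun e => (hlaw e.1 e.2).aemeasurable).1 hindep
  simp only [(hlaw _ _).map_eq] at h1
  refine ⟨aemeasurable_pi_lambda _ fun i => aemeasurable_pi_lambda _ fun j =>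
    (hlaw i j).aemeasurable, ?_⟩
  have h2 := Measure.infinitePi_map_curry (fun (_ : Fin a) (_ : Fin b) => ν)
  simp only [Measure.infinitePi_eq_pi] at h2
  rw [iidMatrixLaw, ← h2, ← h1, AEMeasurable.map_map_of_aemeasurable
    (MeasurableEquiv.measurable _).aemeasurable haem]
  rfl

/-- The first matrix is independent of the product of the others applied to the vector of ones. -/
theorem indepFun_head_prodVec {Ω : Type*} [MeasurableSpace Ω] {P : Measure Ω}
    (p : ℕ) (n : Fin (p + 2) → ℕ)
    (A : (q : Fin (p + 1)) → Ω → Matrix (Fin (n q.castSucc)) (Fin (n q.succ)) ℝ)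
    (hmeas : ∀ q i j, AEMeasurable (fun ω => A q ω i j) P)
    (hindep : iIndepFun (fun (e : Σ q : Fin (p + 1), Fin (n q.castSucc) × Fin (n q.succ)) (ω : Ω) =>
        A e.1 ω e.2.1 e.2.2) P) :
    IndepFun (fun ω i j => A 0 ω i j)
      (fun ω => prodVec p (fun k => n k.succ) fun q => A q.succ ω) P := by
  classical
  -- The index set splits into the entries of the first matrix and all the others; functions of the
  -- two disjoint blocks are independent.
  set S : Finset (Σ q : Fin (p + 1), Fin (n q.castSucc) × Fin (n q.succ)) :=
    Finset.univ.filter fun e => e.1 = 0 with hS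
  have hmemS : ∀ i j, (⟨0, (i, j)⟩ : Σ q : Fin (p + 1), Fin (n q.castSucc) × Fin (n q.succ)) ∈ S :=
    fun i j => by simp [hS]
  have hmemT : ∀ (q : Fin p) i j,
      (⟨q.succ, (i, j)⟩ : Σ q : Fin (p + 1), Fin (n q.castSucc) × Fin (n q.succ)) ∈ Sᶜ :=
    fun q i j => by simp [hS]
  have h := hindep.indepFun_finset₀ S Sᶜ disjoint_compl_right fun e => hmeas _ _ _
  refine h.comp (φ := fun z i j => z ⟨⟨0, (i, j)⟩, hmemS i j⟩)
    (ψ := fun z => prodVec p (fun k => n k.succ) fun q =>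
      (fun i j => z ⟨⟨q.succ, (i, j)⟩, hmemT q i j⟩ :
        Matrix (Fin (n q.succ.castSucc)) (Fin (n q.succ.succ)) ℝ)) ?_ ?_
  · fun_prop
  · exact measurable_prodVec _ _ _ fun q i j => measurable_pi_apply _

/-! ### Moments of the product vector by conditioning -/

/-- Conditioning on `V`, by Tonelli for the joint law. With lower integrals no integrability of `f
(B, V)` has to be known beforehand. -/
theorem lintegral_comp_of_indepFun {Ω α β : Type*} [MeasurableSpace Ω] [MeasurableSpace α]
    [MeasurableSpace β] {P : Measure Ω} [IsProbabilityMeasure P] {B : Ω → α} {V : Ω → β}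
    {ν : Measure α} [IsProbabilityMeasure ν] (hB : HasLaw B ν P) (hV : AEMeasurable V P)
    (h : IndepFun B V P) {f : α → β → ENNReal} (hf : Measurable (Function.uncurry f)) :
    ∫⁻ ω, f (B ω) (V ω) ∂P = ∫⁻ ω, ∫⁻ x, f x (V ω) ∂ν ∂P := by
  have h1 := (indepFun_iff_map_prod_eq_prod_map_map hB.aemeasurable hV).1 h
  have : IsProbabilityMeasure (P.map V) := Measure.isProbabilityMeasure_map hV
  rw [hB.map_eq] at h1
  calc ∫⁻ ω, f (B ω) (V ω) ∂P = ∫⁻ z, Function.uncurry f z ∂(P.map fun ω => (B ω, V ω)) := by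
        rw [lintegral_map' hf.aemeasurable (hB.aemeasurable.prodMk hV)]; rfl
    _ = ∫⁻ c, ∫⁻ x, f x c ∂ν ∂(P.map V) := by
        rw [h1, lintegral_prod_symm _ hf.aemeasurable]; rfl
    _ = _ := by
        exact lintegral_map' (f := fun c => ∫⁻ x, f x c ∂ν)
          (Measurable.lintegral_prod_left' hf).aemeasurable hV

theorem memLp_four_integrable_pow {α : Type*} [MeasurableSpace α] {P : Measure α}
    [IsFiniteMeasure P] {f : α → ℝ} (hf : MemLp f 4 P) :
    Integrable (fun x => f x ^ 2) P ∧ Integrable (fun x => f x ^ 4) P := by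
  refine ⟨(hf.mono_exponent (by norm_num)).integrable_sq, ?_⟩
  have hk' : MemLp f ((4 : ℕ) : ENNReal) P := by exact_mod_cast hf
  have := hk'.integrable_norm_pow'
  simpa [Even.pow_abs (show Even 4 by decide)] using this

theorem sigma_succ_injective {p : ℕ} (n : Fin (p + 2) → ℕ) : Function.Injective
    (fun e : Σ q : Fin p, Fin (n q.castSucc.succ) × Fin (n q.succ.succ) =>
      (⟨e.1.succ, e.2⟩ : Σ q : Fin (p + 1), Fin (n q.castSucc) × Fin (n q.succ))) := by
  rintro ⟨q, e⟩ ⟨q', e'⟩ h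
  simp only [Sigma.mk.injEq, Fin.succ_inj] at h
  obtain ⟨rfl, h⟩ := h
  rw [eq_of_heq h]

theorem sq_sum_sq_le {ι : Type*} (s : Finset ι) (f : ι → ℝ) :
    (∑ i ∈ s, f i ^ 2) ^ 2 ≤ s.card * ∑ i ∈ s, f i ^ 4 := by
  have := sq_sum_le_card_mul_sum_sq (s := s) (f := fun i => f i ^ 2)
  simpa [← pow_mul] using this

theorem iidMatrix_lintegral_moments (ν : Measure ℝ) [IsProbabilityMeasure ν]
    (h4 : MemLp (id : ℝ → ℝ) 4 ν) (h1 : ∫ x, x ∂ν = 0) (h2 : ∫ x, x ^ 2 ∂ν = 1)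
    {K : ℝ} (hK : 3 + ∫ x, x ^ 4 ∂ν ≤ K) (a b : ℕ) (c : Fin b → ℝ) :
    ∫⁻ x, ENNReal.ofReal (∑ i, rowMul x c i ^ 2) ∂(iidMatrixLaw ν a b) =
      ENNReal.ofReal a * ENNReal.ofReal (∑ j, c j ^ 2) ∧
    ∫⁻ x, ENNReal.ofReal (∑ i, rowMul x c i ^ 4) ∂(iidMatrixLaw ν a b) ≤
      ENNReal.ofReal (a * K) * ENNReal.ofReal ((∑ j, c j ^ 2) ^ 2) ∧
    ∫⁻ x, ENNReal.ofReal ((∑ i, rowMul x c i ^ 2) ^ 2) ∂(iidMatrixLaw ν a b) ≤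
      ENNReal.ofReal (a ^ 2 + a * K) * ENNReal.ofReal ((∑ j, c j ^ 2) ^ 2) := by
  obtain ⟨hL, e2, e4, e22⟩ := iidMatrix_moments ν h4 h1 h2 a b c
  have hK0 : 0 ≤ K := le_trans (add_nonneg (by norm_num) (integral_nonneg fun x => by positivity)) hK
  have i2 : Integrable (fun x => ∑ i, rowMul x c i ^ 2) (iidMatrixLaw ν a b) :=
    integrable_finsetSum _ fun i _ => (memLp_four_integrable_pow (hL i)).1
  have i4 : Integrable (fun x => ∑ i, rowMul x c i ^ 4) (iidMatrixLaw ν a b) :=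
    integrable_finsetSum _ fun i _ => (memLp_four_integrable_pow (hL i)).2
  have i22 : Integrable (fun x => (∑ i, rowMul x c i ^ 2) ^ 2) (iidMatrixLaw ν a b) := by
    refine (i4.const_mul (a : ℝ)).mono (i2.1.pow 2) ?_
    filter_upwards with x
    have := sq_sum_sq_le Finset.univ (rowMul x c)
    rw [Finset.card_univ, Fintype.card_fin] at this
    rwa [Real.norm_of_nonneg (by positivity), Real.norm_of_nonneg (by positivity)]
  refine ⟨?_, ?_, ?_⟩
  · rw [← ofReal_integral_eq_lintegral_ofReal i2
      (Filter.Eventually.of_forall fun x => by positivity), e2, ENNReal.ofReal_mul (by positivity)]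
  · rw [← ofReal_integral_eq_lintegral_ofReal i4
      (Filter.Eventually.of_forall fun x => by positivity), ← ENNReal.ofReal_mul (by positivity)]
    refine ENNReal.ofReal_le_ofReal (e4.trans ?_)
    gcongr
  · rw [← ofReal_integral_eq_lintegral_ofReal i22
      (Filter.Eventually.of_forall fun x => by positivity), ← ENNReal.ofReal_mul (by positivity)]
    refine ENNReal.ofReal_le_ofReal (e22.trans ?_)
    gcongr

/-- One step of the recursion over the factors. The conditional moments given `V` involve only `∑
V_i²`, so its first two moments propagate by themselves. -/
theorem rowMul_moments {Ω : Type*} [MeasurableSpace Ω] {P : Measure Ω} [IsProbabilityMeasure P]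
    (ν : Measure ℝ) [IsProbabilityMeasure ν]
    (h4 : MemLp (id : ℝ → ℝ) 4 ν) (h1 : ∫ x, x ∂ν = 0) (h2 : ∫ x, x ^ 2 ∂ν = 1)
    {K : ℝ} (hK : 3 + ∫ x, x ^ 4 ∂ν ≤ K) {a b : ℕ} {B : Ω → Fin a → Fin b → ℝ} {V : Ω → Fin b → ℝ}
    (hB : HasLaw B (iidMatrixLaw ν a b) P) (hV : AEMeasurable V P) (hBV : IndepFun B V P) {N M : ℝ}
    (hV2 : ∫⁻ ω, ENNReal.ofReal (∑ i, V ω i ^ 2) ∂P = ENNReal.ofReal N)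
    (hV22 : ∫⁻ ω, ENNReal.ofReal ((∑ i, V ω i ^ 2) ^ 2) ∂P ≤ ENNReal.ofReal M) :
    AEMeasurable (fun ω => rowMul (B ω) (V ω)) P ∧
    ∫⁻ ω, ENNReal.ofReal (∑ i, rowMul (B ω) (V ω) i ^ 2) ∂P = ENNReal.ofReal (a * N) ∧
    ∫⁻ ω, ENNReal.ofReal (∑ i, rowMul (B ω) (V ω) i ^ 4) ∂P ≤ ENNReal.ofReal (a * K * M) ∧
    ∫⁻ ω, ENNReal.ofReal ((∑ i, rowMul (B ω) (V ω) i ^ 2) ^ 2) ∂P ≤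
      ENNReal.ofReal ((a ^ 2 + a * K) * M) := by
  have hK0 : 0 ≤ K := le_trans (add_nonneg (by norm_num) (integral_nonneg fun x => by positivity)) hK
  have hm2 : ∀ k l : ℕ, Measurable (Function.uncurry
      fun (x : Fin a → Fin b → ℝ) (c : Fin b → ℝ) =>
        ENNReal.ofReal ((∑ i, rowMul x c i ^ k) ^ l)) := by
    intro k l
    have : Measurable fun z : (Fin a → Fin b → ℝ) × (Fin b → ℝ) =>
        (∑ i, rowMul z.1 z.2 i ^ k) ^ l := by
      unfold rowMul; fun_prop
    exact this.ennreal_ofReal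
  have hmom := fun ω => iidMatrix_lintegral_moments ν h4 h1 h2 hK a b (V ω)
  refine ⟨measurable_rowMul.comp_aemeasurable (hB.aemeasurable.prodMk hV), ?_, ?_, ?_⟩
  · rw [lintegral_comp_of_indepFun hB hV hBV
      (f := fun x c => ENNReal.ofReal (∑ i, rowMul x c i ^ 2)) (by simpa using hm2 2 1),
      lintegral_congr fun ω => (hmom ω).1, lintegral_const_mul' _ _ ENNReal.ofReal_ne_top, hV2,
      ← ENNReal.ofReal_mul (by positivity)]
  · rw [lintegral_comp_of_indepFun hB hV hBV
      (f := fun x c => ENNReal.ofReal (∑ i, rowMul x c i ^ 4)) (by simpa using hm2 4 1)]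
    refine (lintegral_mono fun ω => (hmom ω).2.1).trans ?_
    rw [lintegral_const_mul' _ _ ENNReal.ofReal_ne_top, ENNReal.ofReal_mul (q := M) (by positivity)]
    gcongr
  · rw [lintegral_comp_of_indepFun hB hV hBV
      (f := fun x c => ENNReal.ofReal ((∑ i, rowMul x c i ^ 2) ^ 2)) (hm2 2 2)]
    refine (lintegral_mono fun ω => (hmom ω).2.2).trans ?_
    rw [lintegral_const_mul' _ _ ENNReal.ofReal_ne_top, ENNReal.ofReal_mul (q := M) (by positivity)]
    gcongr

/-- Moments of the product of independent matrices applied to the vector of ones. -/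
theorem prodVec_moments {Ω : Type*} [MeasurableSpace Ω] (P : Measure Ω) [IsProbabilityMeasure P]
    {K : ℝ} (hK : 1 ≤ K) (p : ℕ) (n : Fin (p + 1) → ℕ) (hn : ∀ k, 0 < n k)
    (μ : Fin p → Measure ℝ) (hprob : ∀ q, IsProbabilityMeasure (μ q))
    (h4 : ∀ q, MemLp (id : ℝ → ℝ) 4 (μ q)) (h1 : ∀ q, ∫ x, x ∂(μ q) = 0)
    (h2 : ∀ q, ∫ x, x ^ 2 ∂(μ q) = 1) (hκ : ∀ q, 3 + ∫ x, x ^ 4 ∂(μ q) ≤ K)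
    (A : (q : Fin p) → Ω → Matrix (Fin (n q.castSucc)) (Fin (n q.succ)) ℝ)
    (hlaw : ∀ q i j, HasLaw (fun ω => A q ω i j) (μ q) P)
    (hindep : iIndepFun (fun (e : Σ q : Fin p, Fin (n q.castSucc) × Fin (n q.succ)) (ω : Ω) =>
        A e.1 ω e.2.1 e.2.2) P) :
    AEMeasurable (fun ω => prodVec p n fun q => A q ω) P ∧
    ∫⁻ ω, ENNReal.ofReal (∑ i, prodVec p n (fun q => A q ω) i ^ 2) ∂P =
      ENNReal.ofReal (∏ k, (n k : ℝ)) ∧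
    ∫⁻ ω, ENNReal.ofReal (∑ i, prodVec p n (fun q => A q ω) i ^ 4) ∂P ≤
      ENNReal.ofReal (K * ((∏ k, (n k : ℝ)) ^ 2 / n 0) * ∏ q : Fin p, (1 + K / n q.castSucc)) ∧
    ∫⁻ ω, ENNReal.ofReal ((∑ i, prodVec p n (fun q => A q ω) i ^ 2) ^ 2) ∂P ≤
      ENNReal.ofReal ((∏ k, (n k : ℝ)) ^ 2 * ∏ q : Fin p, (1 + K / n q.castSucc)) := by
  induction p with
  | zero =>
    simp only [prodVec_zero]
    have h0 : (0 : ℝ) < n 0 := by exact_mod_cast hn 0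
    refine ⟨aemeasurable_const, by simp, ?_, by simp⟩
    simp only [one_pow, Finset.sum_const, Finset.card_univ, Fintype.card_fin, nsmul_eq_mul,
      mul_one, lintegral_const, measure_univ, Finset.univ_eq_empty, Finset.prod_empty]
    have e : ∏ k : Fin (0 + 1), (n k : ℝ) = n 0 := by simp
    refine ENNReal.ofReal_le_ofReal ?_
    rw [e, pow_two, mul_div_assoc, div_self h0.ne', mul_one]
    exact le_mul_of_one_le_left h0.le hK
  | succ p ih =>
    -- The fourth-power bound is not inherited: multiplying by a fresh matrix creates delocalization
    -- anew.
    obtain ⟨ihm, ih2, -, ih22⟩ := ih (fun k => n k.succ) (fun k => hn _) (fun q => μ q.succ)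
      (fun q => hprob _) (fun q => h4 _) (fun q => h1 _) (fun q => h2 _) (fun q => hκ _)
      (fun q => A q.succ) (fun q i j => hlaw q.succ i j) (hindep.precomp (sigma_succ_injective n))
    have hB : HasLaw (fun ω i j => A 0 ω i j) (iidMatrixLaw (μ 0) (n 0) (n 1)) P :=
      hasLaw_iidMatrixLaw (fun i j => hlaw 0 i j)
        (hindep.precomp (g := fun e : Fin (n 0) × Fin (n 1) =>
          (⟨0, e⟩ : Σ q : Fin (p + 1), Fin (n q.castSucc) × Fin (n q.succ)))
          (sigma_mk_injective (i := (0 : Fin (p + 1)))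
            (β := fun q : Fin (p + 1) => Fin (n q.castSucc) × Fin (n q.succ))))
    have hBV := indepFun_head_prodVec p n A (fun q i j => (hlaw q i j).aemeasurable) hindep
    have := hprob 0
    obtain ⟨r1, r2, r3, r4⟩ := rowMul_moments (μ 0) (h4 0) (h1 0) (h2 0) (hκ 0) hB ihm hBV ih2 ih22
    have e1 : ∏ k, (n k : ℝ) = n 0 * ∏ k : Fin (p + 1), (n k.succ : ℝ) := Fin.prod_univ_succ _
    have e2 : ∏ q : Fin (p + 1), (1 + K / (n q.castSucc : ℝ)) =
      (1 + K / n 0) * ∏ q : Fin p, (1 + K / (n q.castSucc.succ : ℝ)) := Fin.prod_univ_succ _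
    have h0 : (0 : ℝ) < n 0 := by exact_mod_cast hn 0
    have hKpos : 0 < K := by linarith
    have hQ : 0 ≤ ∏ q : Fin p, (1 + K / (n q.castSucc.succ : ℝ)) :=
      Finset.prod_nonneg fun q _ => by positivity
    simp only [prodVec_succ]
    rw [e1, e2]
    refine ⟨r1, r2, r3.trans (ENNReal.ofReal_le_ofReal ?_),
      r4.trans (ENNReal.ofReal_le_ofReal (le_of_eq ?_))⟩
    · set N := ∏ k : Fin (p + 1), (n k.succ : ℝ)
      set Q := ∏ q : Fin p, (1 + K / (n q.castSucc.succ : ℝ))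
      calc (n 0 : ℝ) * K * (N ^ 2 * Q) ≤ (n 0 : ℝ) * K * (N ^ 2 * Q) * (1 + K / n 0) :=
            le_mul_of_one_le_right (by positivity) (by
              have : 0 ≤ K / n 0 := by positivity
              linarith)
        _ = K * ((n 0 * N) ^ 2 / n 0) * ((1 + K / n 0) * Q) := by
          field_simp
    · set N := ∏ k : Fin (p + 1), (n k.succ : ℝ)
      set Q := ∏ q : Fin p, (1 + K / (n q.castSucc.succ : ℝ))
      change ((n 0 : ℝ) ^ 2 + n 0 * K) * (N ^ 2 * Q) = (n 0 * N) ^ 2 * ((1 + K / n 0) * Q)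
      field_simp

/-! ### From moments to probabilities, and normalization of the vector -/

/-- Given `V`, the probability of `E` is at most `δ` on `G` and at most 1 elsewhere. The set `G`
need not be measurable, since the integral of an indicator never exceeds the outer measure of its
set. -/
theorem measureReal_mem_le_of_indepFun {Ω α β : Type*} [MeasurableSpace Ω] [MeasurableSpace α]
    [MeasurableSpace β] {P : Measure Ω} [IsProbabilityMeasure P] {B : Ω → α} {V : Ω → β}
    {ν : Measure α} [IsProbabilityMeasure ν] (hB : HasLaw B ν P) (hV : AEMeasurable V P)
    (h : IndepFun B V P) {E : Set (α × β)} (hE : MeasurableSet E) {G : Set β} {δ : ℝ} (hδ : 0 ≤ δ)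
    (hG : ∀ c ∈ G, ν.real {x | (x, c) ∈ E} ≤ δ) :
    P.real {ω | (B ω, V ω) ∈ E} ≤ P.real {ω | V ω ∉ G} + δ := by
  have hnull : NullMeasurableSet {ω | (B ω, V ω) ∈ E} P :=
    (hB.aemeasurable.prodMk hV).nullMeasurableSet_preimage hE
  have h1 := lintegral_comp_of_indepFun hB hV h
    (f := fun x c => E.indicator (fun _ => (1 : ENNReal)) (x, c))
    (measurable_const.indicator hE)
  have e1 : ∫⁻ ω, E.indicator (fun _ => (1 : ENNReal)) (B ω, V ω) ∂P =
      P {ω | (B ω, V ω) ∈ E} := by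
    rw [← lintegral_indicator_one₀ hnull]; rfl
  have e2 : ∀ c, ∫⁻ x, E.indicator (fun _ => (1 : ENNReal)) (x, c) ∂ν = ν {x | (x, c) ∈ E} := by
    intro c
    have hm : MeasurableSet {x | (x, c) ∈ E} := measurable_prodMk_right hE
    rw [← lintegral_indicator_one hm]; rfl
  simp only [e2] at h1
  rw [e1] at h1
  have h2 : P {ω | (B ω, V ω) ∈ E} ≤ P {ω | V ω ∉ G} + ENNReal.ofReal δ := by
    rw [h1]
    calc ∫⁻ ω, ν {x | (x, V ω) ∈ E} ∂P
        ≤ ∫⁻ ω, ({ω | V ω ∉ G}.indicator (fun _ => 1) ω + ENNReal.ofReal δ) ∂P := by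
          refine lintegral_mono fun ω => ?_
          by_cases hω : V ω ∈ G
          · refine le_trans ?_ le_add_self
            rw [← ofReal_measureReal]
            exact ENNReal.ofReal_le_ofReal (hG _ hω)
          · refine le_trans ?_ le_self_add
            rw [Set.indicator_of_mem (by exact hω)]
            exact prob_le_one
      _ = ∫⁻ ω, {ω | V ω ∉ G}.indicator (fun _ => 1) ω ∂P + ENNReal.ofReal δ := by
          rw [lintegral_add_right _ measurable_const]; simp
      _ ≤ _ := by
          gcongr
          simpa using lintegral_indicator_const_le (μ := P) {ω | V ω ∉ G} 1
  have h3 := ENNReal.toReal_mono (by finiteness) h2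
  rwa [ENNReal.toReal_add (by finiteness) (by finiteness), ENNReal.toReal_ofReal hδ] at h3

/-- Chebyshev's inequality in terms of lower Lebesgue integrals. -/
theorem measureReal_abs_sub_ge_le {Ω : Type*} [MeasurableSpace Ω] {P : Measure Ω}
    [IsProbabilityMeasure P] {X : Ω → ℝ} (hX : AEMeasurable X P) (hX0 : ∀ ω, 0 ≤ X ω) {N Q θ : ℝ}
    (hN : 0 < N) (hQ : 0 ≤ Q) (hθ : 0 < θ) (h1 : ∫⁻ ω, ENNReal.ofReal (X ω) ∂P = ENNReal.ofReal N)
    (h2 : ∫⁻ ω, ENNReal.ofReal (X ω ^ 2) ∂P ≤ ENNReal.ofReal (N ^ 2 * Q)) :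
    P.real {ω | θ * N ≤ |X ω - N|} ≤ (Q - 1) / θ ^ 2 := by
  have hmean : ∫ ω, X ω ∂P = N := by
    rw [integral_eq_lintegral_of_nonneg_ae (Filter.Eventually.of_forall hX0)
      hX.aestronglyMeasurable, h1, ENNReal.toReal_ofReal hN.le]
  have hL2 : MemLp X 2 P := by
    rw [memLp_two_iff_integrable_sq hX.aestronglyMeasurable]
    refine ⟨(hX.pow_const 2).aestronglyMeasurable, ?_⟩
    rw [hasFiniteIntegral_iff_ofReal (Filter.Eventually.of_forall fun ω => sq_nonneg _)]
    exact h2.trans_lt ENNReal.ofReal_lt_top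
  have hsq : ∫ ω, X ω ^ 2 ∂P ≤ N ^ 2 * Q := by
    rw [integral_eq_lintegral_of_nonneg_ae (Filter.Eventually.of_forall fun ω => sq_nonneg _)
      (hX.pow_const 2).aestronglyMeasurable]
    exact ENNReal.toReal_le_of_le_ofReal (by positivity) h2
  have hvar : Var[X; P] ≤ N ^ 2 * (Q - 1) := by
    rw [variance_eq_sub hL2, hmean]
    simp only [Pi.pow_apply]
    linarith
  have hc := meas_ge_le_variance_div_sq hL2 (c := θ * N) (by positivity)
  rw [hmean] at hc
  have : P.real {ω | θ * N ≤ |X ω - N|} ≤ Var[X; P] / (θ * N) ^ 2 :=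
    ENNReal.toReal_le_of_le_ofReal (div_nonneg (variance_nonneg _ _) (by positivity)) hc
  refine this.trans ?_
  rw [div_le_div_iff₀ (by positivity) (by positivity)]
  calc _ ≤ N ^ 2 * (Q - 1) * θ ^ 2 := by gcongr
    _ = _ := by ring

/-- Markov's inequality in terms of lower Lebesgue integrals. -/
theorem measureReal_ge_le_div {Ω : Type*} [MeasurableSpace Ω] {P : Measure Ω}
    [IsProbabilityMeasure P] {X : Ω → ℝ} (hX : AEMeasurable X P) {D t : ℝ} (hD : 0 ≤ D)
    (ht : 0 < t) (h : ∫⁻ ω, ENNReal.ofReal (X ω) ∂P ≤ ENNReal.ofReal D) :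
    P.real {ω | t ≤ X ω} ≤ D / t := by
  have h1 := meas_ge_le_lintegral_div (μ := P) (f := fun ω => ENNReal.ofReal (X ω))
    hX.ennreal_ofReal (ε := ENNReal.ofReal t) (by simpa using ht) ENNReal.ofReal_ne_top
  refine ENNReal.toReal_le_of_le_ofReal (by positivity) ?_
  rw [ENNReal.ofReal_div_of_pos ht]
  refine (measure_mono fun ω hω => ?_).trans (h1.trans (by gcongr))
  exact ENNReal.ofReal_le_ofReal hω

theorem rowMul_smul {a b : ℕ} (x : Fin a → Fin b → ℝ) (r : ℝ) (c : Fin b → ℝ) :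
    rowMul x (r • c) = r • rowMul x c := by
  ext i
  simp only [rowMul, Pi.smul_apply, smul_eq_mul, Finset.mul_sum]
  exact Finset.sum_congr rfl fun j _ => by ring

/-- The version of `eventually_norm_rowMul_concentrates` for vectors of squared length close
to `N`. -/
theorem eventually_norm_rowMul_concentrates_of_near (ν : Measure ℝ) [IsProbabilityMeasure ν]
    (h4 : MemLp (id : ℝ → ℝ) 4 ν) (h1 : ∫ x, x ∂ν = 0) (h2 : ∫ x, x ^ 2 ∂ν = 1)
    (K : ℝ) {θ δ : ℝ} (hθ : 0 < θ) (hθ1 : θ ≤ 1 / 2) (hδ : 0 < δ) :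
    ∀ᶠ a : ℕ in Filter.atTop, ∀ (b : ℕ) (c : Fin b → ℝ) (N : ℝ), 0 < N →
      |∑ j, c j ^ 2 - N| < θ * N → ∑ j, c j ^ 4 < K * N ^ 2 / a →
      (iidMatrixLaw ν a b).real {x | 3 * θ ≤
        |(√(2 * N * Real.log a))⁻¹ * ‖rowMul x c‖ - 1|} ≤ δ := by
  have hlog : Filter.Tendsto (fun a : ℕ => Real.log a) Filter.atTop Filter.atTop :=
    Real.tendsto_log_atTop.comp tendsto_natCast_atTop_atTop
  -- The factor 4 pays for the normalization: the squared length exceeds `N / 2`, so `N ^ 2` is at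
  -- most 4 times its square.
  filter_upwards [eventually_norm_rowMul_concentrates ν h4 h1 h2 (4 * K) hθ (by linarith) hδ,
    hlog.eventually_ge_atTop 1] with a ha hL b c N hN hc2 hc4
  set L := Real.log a with hLdef
  set s := ∑ j, c j ^ 2 with hs
  obtain ⟨hs1, hs2⟩ := abs_lt.1 hc2
  have hsN : N / 2 < s := by nlinarith
  have hs0 : 0 < s := by linarith
  have hss : √s ^ 2 = s := Real.sq_sqrt hs0.le
  have hsp : 0 < √s := Real.sqrt_pos.2 hs0
  set w : Fin b → ℝ := (√s)⁻¹ • c with hw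
  have hcw : c = √s • w := by
    rw [hw, smul_smul, mul_inv_cancel₀ hsp.ne', one_smul]
  have hw2 : ∑ j, w j ^ 2 = 1 := by
    simp only [hw, Pi.smul_apply, smul_eq_mul, mul_pow]
    rw [← Finset.mul_sum, inv_pow, hss, ← hs, inv_mul_cancel₀ hs0.ne']
  have hw4 : ∑ j, w j ^ 4 ≤ 4 * K / a := by
    simp only [hw, Pi.smul_apply, smul_eq_mul, mul_pow]
    rw [← Finset.mul_sum, inv_pow, show √s ^ 4 = (√s ^ 2) ^ 2 by ring, hss,
      inv_mul_le_iff₀ (by positivity)]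
    refine hc4.le.trans ?_
    have hKa : 0 ≤ K / a := by
      have h5 : 0 < K * N ^ 2 / a :=
        lt_of_le_of_lt (Finset.sum_nonneg fun j _ => by positivity) hc4
      have h6 : K * N ^ 2 / a = K / a * N ^ 2 := by ring
      rw [h6] at h5
      exact (pos_of_mul_pos_left h5 (by positivity)).le
    calc K * N ^ 2 / a = K / a * N ^ 2 := by ring
      _ ≤ K / a * (4 * s ^ 2) := by gcongr; nlinarith
      _ = _ := by ring
  refine (measureReal_mono fun x hx => ?_).trans (ha b w hw2 hw4)
  simp only [Set.mem_ofPred_eq] at hx ⊢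
  by_contra! hcon
  set R := √(2 * L) with hR
  have hR0 : 0 < R := by positivity
  have hsqrt : √(2 * N * L) = √N * R := by
    rw [hR, ← Real.sqrt_mul hN.le]; ring_nf
  have hNp : 0 < √N := Real.sqrt_pos.2 hN
  have hNN : √N ^ 2 = N := Real.sq_sqrt hN.le
  set r := √s / √N with hr
  have hr0 : 0 < r := by positivity
  have hr2 : r ^ 2 = s / N := by rw [hr, div_pow, hss, hNN]
  set u := ‖rowMul x w‖ / R with hu
  have hu1 : |u - 1| < θ := by
    have : u - 1 = (‖rowMul x w‖ - R) / R := by rw [hu]; field_simp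
    rw [this, abs_div, abs_of_pos hR0, div_lt_iff₀ hR0]
    exact hcon
  have hr1 : |r - 1| < θ := by
    have h5 : |r ^ 2 - 1| < θ := by
      have : r ^ 2 - 1 = (s - N) / N := by rw [hr2]; field_simp
      rw [this, abs_div, abs_of_pos hN, div_lt_iff₀ hN]
      exact hc2
    have h6 : |r ^ 2 - 1| = |r - 1| * (r + 1) := by
      rw [show r ^ 2 - 1 = (r - 1) * (r + 1) by ring, abs_mul, abs_of_pos (by linarith : 0 < r + 1)]
    nlinarith [abs_nonneg (r - 1)]
  have hprod : (√(2 * N * L))⁻¹ * ‖rowMul x c‖ = r * u := by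
    rw [hcw, rowMul_smul, norm_smul, hsqrt, Real.norm_of_nonneg hsp.le, hr, hu]
    field_simp
  rw [hprod] at hx
  -- Both ratios are within `θ` of 1, so the error is below `θ ^ 2 + 2 * θ ≤ 3 * θ`.
  have h7 : |r * u - 1| ≤ |r - 1| * |u - 1| + |r - 1| + |u - 1| := by
    have : r * u - 1 = (r - 1) * (u - 1) + (r - 1) + (u - 1) := by ring
    rw [this, ← abs_mul]
    exact (abs_add_le _ _).trans (by gcongr; exact abs_add_le _ _)
  nlinarith [abs_nonneg (r - 1), abs_nonneg (u - 1)]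

/-! ### Assembly of the theorem -/

theorem theorem1p6
    (p : ℕ) (hp : 1 ≤ p)
    -- the law of the entries of each matrix, kept fixed as the sizes vary
    (μ : Fin p → Measure ℝ)
    (hmoment : ∀ q, MemLp (id : ℝ → ℝ) 4 (μ q))
    (hmean : ∀ q, ∫ x, x ∂(μ q) = 0)
    (hvar : ∀ q, Var[(id : ℝ → ℝ); μ q] = 1)
    -- for each size vector `n`, independent random matrices on some probability space
    {Ω : (Fin (p + 1) → ℕ) → Type*} [∀ n, MeasurableSpace (Ω n)]
    (Pr : ∀ n, Measure (Ω n)) [∀ n, IsProbabilityMeasure (Pr n)]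
    (A : ∀ (n : Fin (p + 1) → ℕ) (q : Fin p),
      Ω n → Matrix (Fin (n q.castSucc)) (Fin (n q.succ)) ℝ)
    (hlaw : ∀ n q i j, HasLaw (fun ω => A n q ω i j) (μ q) (Pr n))
    (hindep : ∀ n, iIndepFun
      (fun (e : Σ q : Fin p, Fin (n q.castSucc) × Fin (n q.succ)) (ω : Ω n) =>
        A n e.1 ω e.2.1 e.2.2) (Pr n))
    -- the number of columns of the matrix of ones, depending on the sizes in any way
    (m : (Fin (p + 1) → ℕ) → ℕ) (hm : ∀ n, 1 ≤ m n) :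
    TendstoInProbComparable Pr
      (fun n ω => (m n : ℝ)⁻¹ *
        (2 * (∏ q : Fin p, (n q.succ : ℝ)) * Real.log (n 0)) ^ (-(1 / 2 : ℝ)) *
        linftyNorm (matProd p n (fun q => A n q ω) * onesMatrix (n (Fin.last p)) (m n)))
      1 := by
  obtain ⟨p, rfl⟩ : ∃ p', p = p' + 1 := ⟨p - 1, by omega⟩
  -- Any positive size vector has an entry of law `μ q`; the one with all sizes 1 serves here.
  have hprob : ∀ q, IsProbabilityMeasure (μ q) := fun q =>
    (hlaw (fun _ => 1) q 0 0).isProbabilityMeasure_iff.1 inferInstance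
  have hvar2 : ∀ q, ∫ x, x ^ 2 ∂(μ q) = 1 := by
    intro q
    have := hvar q
    rwa [variance_of_integral_eq_zero aemeasurable_id (hmean q)] at this
  intro C ε δ hε hδ
  set K : ℝ := 3 + ∑ q, ∫ x, x ^ 4 ∂(μ q) with hKdef
  have hint4 : ∀ q, 0 ≤ ∫ x, x ^ 4 ∂(μ q) := fun q => integral_nonneg fun x => by positivity
  have hκ : ∀ q, 3 + ∫ x, x ^ 4 ∂(μ q) ≤ K := fun q => by
    rw [hKdef]
    gcongr
    exact Finset.single_le_sum (f := fun q => ∫ x, x ^ 4 ∂(μ q)) (fun q _ => hint4 q)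
      (Finset.mem_univ q)
  have hK3 : 3 ≤ K := le_add_of_nonneg_right (Finset.sum_nonneg fun q _ => hint4 q)
  have hK0 : 0 < K := by linarith
  set C' := max C 1 with hC'
  have hC'0 : 0 < C' := lt_of_lt_of_le one_pos (le_max_right _ _)
  set θ := min (ε / 3) (1 / 2) with hθdef
  have hθ : 0 < θ := by positivity
  have hθε : 3 * θ ≤ ε := by
    have := min_le_left (ε / 3) (1 / 2)
    linarith
  -- Chosen so that Markov's inequality for `∑ V_j⁴` costs `δ / 8 * Q`, hence at most `δ / 4` when
  -- `Q ≤ 2`.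
  set K₁ := 8 * K * C' / δ with hK₁
  have hK₁0 : 0 < K₁ := by positivity
  have hlimQ : Filter.Tendsto (fun M : ℕ => (1 + K / (M : ℝ)) ^ p) Filter.atTop (nhds 1) := by
    have h : Filter.Tendsto (fun M : ℕ => K / (M : ℝ)) Filter.atTop (nhds 0) :=
      tendsto_const_nhds.div_atTop tendsto_natCast_atTop_atTop
    simpa using (h.const_add 1).pow p
  -- The bound 2 is for Markov; the bound `1 + θ ^ 2 * (δ / 4)` makes the Chebyshev error `(Q - 1) /
  -- θ ^ 2` at most `δ / 4`.
  have hQev := hlimQ.eventually (ge_mem_nhds (show (1 : ℝ) < min 2 (1 + θ ^ 2 * (δ / 4)) by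
    rw [lt_min_iff]; constructor
    · norm_num
    · have : 0 < θ ^ 2 * (δ / 4) := by positivity
      linarith))
  obtain ⟨M, hM⟩ := Filter.eventually_atTop.1 ((hQev.and
    (eventually_norm_rowMul_concentrates_of_near (μ 0) (hmoment 0) (hmean 0) (hvar2 0) K₁ hθ
      (min_le_right _ _) (half_pos hδ))).and (Filter.eventually_ge_atTop 2))
  refine ⟨M, fun n hn => ?_⟩
  obtain ⟨⟨hQM, -⟩, hM2⟩ := hM M le_rfl
  obtain ⟨⟨-, hcore⟩, -⟩ := hM (n 0) (hn 0 0).1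
  have hn0 : ∀ k, 0 < n k := fun k => by have := (hn k k).1; omega
  have hnR : ∀ k, (0 : ℝ) < n k := fun k => by exact_mod_cast hn0 k
  have hMR : (0 : ℝ) < M := by exact_mod_cast (by omega : 0 < M)
  set P := Pr n with hP
  set V : Ω n → Fin (n 1) → ℝ :=
    fun ω => prodVec p (fun k => n k.succ) fun q => A n q.succ ω with hV
  set B : Ω n → Fin (n 0) → Fin (n 1) → ℝ := fun ω i j => A n 0 ω i j with hBdef
  set N : ℝ := ∏ q : Fin (p + 1), (n q.succ : ℝ) with hN
  have hN0 : 0 < N := Finset.prod_pos fun q _ => hnR _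
  set Q : ℝ := ∏ q : Fin p, (1 + K / (n q.castSucc.succ : ℝ)) with hQ
  have hQ0 : 0 ≤ Q := Finset.prod_nonneg fun q _ => by have := hnR q.castSucc.succ; positivity
  have hQle : Q ≤ min 2 (1 + θ ^ 2 * (δ / 4)) := by
    refine le_trans ?_ hQM
    calc Q ≤ ∏ q : Fin p, (1 + K / (M : ℝ)) := by
          refine Finset.prod_le_prod (fun q _ => by have := hnR q.castSucc.succ; positivity)
            fun q _ => ?_
          have : (M : ℝ) ≤ n q.castSucc.succ := by exact_mod_cast (hn q.castSucc.succ 0).1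
          gcongr
      _ = _ := by simp
  obtain ⟨hVm, hV2, hV4, hV22⟩ := prodVec_moments P (by linarith : 1 ≤ K) p (fun k => n k.succ)
    (fun k => hn0 _) (fun q => μ q.succ) (fun q => hprob _) (fun q => hmoment _)
    (fun q => hmean _) (fun q => hvar2 _) (fun q => hκ _) (fun q => A n q.succ)
    (fun q i j => hlaw n q.succ i j) ((hindep n).precomp (sigma_succ_injective n))
  have hB : HasLaw B (iidMatrixLaw (μ 0) (n 0) (n 1)) P :=
    hasLaw_iidMatrixLaw (fun i j => hlaw n 0 i j)
      ((hindep n).precomp (g := fun e : Fin (n 0) × Fin (n 1) =>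
        (⟨0, e⟩ : Σ q : Fin (p + 1), Fin (n q.castSucc) × Fin (n q.succ)))
        (sigma_mk_injective (i := (0 : Fin (p + 1)))
          (β := fun q : Fin (p + 1) => Fin (n q.castSucc) × Fin (n q.succ))))
  have hBV : IndepFun B V P :=
    indepFun_head_prodVec p n (A n) (fun q i j => (hlaw n q i j).aemeasurable) (hindep n)
  have hred : ∀ ω, (m n : ℝ)⁻¹ * (2 * N * Real.log (n 0)) ^ (-(1 / 2 : ℝ)) *
      linftyNorm (matProd (p + 1) n (fun q => A n q ω) *
        onesMatrix (n (Fin.last (p + 1))) (m n)) =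
      (√(2 * N * Real.log (n 0)))⁻¹ * ‖rowMul (B ω) (V ω)‖ := by
    intro ω
    have hm0 : (m n : ℝ) ≠ 0 := by
      have := hm n
      exact_mod_cast (by omega : m n ≠ 0)
    have hlog0 : 0 ≤ Real.log (n 0) := Real.log_natCast_nonneg _
    rw [linftyNorm_mul_onesMatrix _ (hm n), Real.rpow_neg (by positivity), ← Real.sqrt_eq_rpow,
      show (matProd (p + 1) n fun q => A n q ω).mulVec (fun _ => 1) = rowMul (B ω) (V ω) from
        prodVec_succ p n _]
    field_simp
  set E : Set ((Fin (n 0) → Fin (n 1) → ℝ) × (Fin (n 1) → ℝ)) :=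
    {z | ε ≤ |(√(2 * N * Real.log (n 0)))⁻¹ * ‖rowMul z.1 z.2‖ - 1|} with hE
  have hEm : MeasurableSet E :=
    measurableSet_le measurable_const
      ((measurable_rowMul.norm.const_mul _).sub_const _).abs
  -- The good vectors: length close to its typical value, and delocalized. The budget is `δ / 2` for
  -- the first matrix given a good `V`, and `δ / 4` for each way of leaving `G`.
  set G : Set (Fin (n 1) → ℝ) :=
    {c | |∑ j, c j ^ 2 - N| < θ * N ∧ ∑ j, c j ^ 4 < K₁ * N ^ 2 / n 0} with hG
  have hmain : P.real {ω | (B ω, V ω) ∈ E} ≤ P.real {ω | V ω ∉ G} + δ / 2 :=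
    measureReal_mem_le_of_indepFun hB hVm hBV hEm (G := G) (half_pos hδ).le
    fun c hc => (measureReal_mono fun x (hx : ε ≤ _) => hθε.trans hx).trans
      (hcore (n 1) c N hN0 hc.1 hc.2)
  refine (measureReal_mono fun ω hω => ?_).trans (hmain.trans ?_)
  · change ε ≤ |(√(2 * N * Real.log (n 0)))⁻¹ * ‖rowMul (B ω) (V ω)‖ - 1|
    rw [← hred ω]
    exact hω
  have hsub : {ω | V ω ∉ G} ⊆ {ω | θ * N ≤ |∑ j, V ω j ^ 2 - N|} ∪
      {ω | K₁ * N ^ 2 / n 0 ≤ ∑ j, V ω j ^ 4} := by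
    intro ω hω
    by_contra hcon
    simp only [Set.mem_union, Set.mem_ofPred_eq, not_or, not_le] at hcon
    exact hω hcon
  have hS : ∀ k, AEMeasurable (fun ω => ∑ j, V ω j ^ k) P := fun k => by
    have : Measurable fun c : Fin (n 1) → ℝ => ∑ j, c j ^ k := by fun_prop
    exact this.comp_aemeasurable hVm
  have b1 := measureReal_abs_sub_ge_le (hS 2) (fun ω => Finset.sum_nonneg fun j _ => sq_nonneg _)
    hN0 hQ0 hθ hV2 hV22
  have b2 := measureReal_ge_le_div (hS 4) (t := K₁ * N ^ 2 / n 0) (by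
      have := hnR 1
      change 0 ≤ K * (N ^ 2 / n 1) * Q
      positivity) (by have := hnR 0; positivity) hV4
  have c1 : (Q - 1) / θ ^ 2 ≤ δ / 4 := by
    rw [div_le_iff₀ (by positivity)]
    have := hQle.trans (min_le_right _ _)
    linarith
  have c2 : K * (N ^ 2 / n 1) * Q / (K₁ * N ^ 2 / n 0) ≤ δ / 4 := by
    have h1 := hnR 1
    have h0 := hnR 0
    have hQ2 : Q ≤ 2 := hQle.trans (min_le_left _ _)
    -- The only use of comparability: `V` has `n 1` coordinates, whereas delocalization is measured
    -- against `n 0`.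
    have hcomp : (n 0 : ℝ) ≤ C' * n 1 := (hn 0 1).2.trans (by gcongr; exact le_max_left _ _)
    calc K * (N ^ 2 / n 1) * Q / (K₁ * N ^ 2 / n 0) = (δ / 8) * Q * (n 0 / (C' * n 1)) := by
          rw [hK₁]; field_simp
      _ ≤ (δ / 8) * 2 * 1 := by
          gcongr
          rw [div_le_one (by positivity)]
          exact hcomp
      _ = _ := by ring
  have hfin := (measureReal_mono hsub (μ := P)).trans (measureReal_union_le _ _)
  have b2' : P.real {ω | K₁ * N ^ 2 / n 0 ≤ ∑ j, V ω j ^ 4} ≤ δ / 4 := b2.trans c2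
  linarith [b1.trans c1]
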